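/- **Conventions.** Let $\mathcal P=\mathcal P_0\oplus\mathcal P_1$ be a small algebra: a finite-dimensional real unital $\mathbb Z_2$-graded commutative algebra ($ab=(-1)^{|a||b|}ba$ for homogeneous $a,b$) with a unital algebra projection $\#:\mathcal P\to\mathbb R$ whose kernel is nilpotent. Let $I\subset\mathbb R$ be an open interval and let $I^{|n}$ be the supermanifold with body $I$ and structure sheaf $\mathcal P\boxtimes(\mathcal C^\infty_I\otimes\bigwedge\mathbb R^n)$, $\boxtimes$ being the graded tensor product; $I=I^{|0}$ has structure sheaf $\mathcal P\otimes\mathcal C^\infty_I$. For a sheaf $\mathcal S$ of graded algebras, $\mathcal S^{p|q}$ denotes the module $\mathcal S^{p+q}$ with parity reversed in the last $q$ components (similarly for $\mathcal P^{p|q}$). A $\mathcal P$-super vector bundle of super rank $(p,q)$ is a sheaf of graded modules over the structure sheaf $\mathcal S$ that is locally isomorphic (by even isomorphisms) to the trivial bundle $\mathcal S^{p|q}$. A $\mathcal P$-connection on a bundle $\mathcal E$ on $I$ is an even $\mathcal P$-linear sheaf morphism $\nabla:\mathcal E\to sT^*I\boxtimes\mathcal E$ with $\nabla(fS)=df\otimes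 S+f\nabla S$, where $sTI$ is the sheaf of $\mathcal P$-linear super derivations of $\mathcal P\otimes\mathcal C_I^\infty$; the trivial connection on a trivial bundle is the one that annihilates the standard frame. A section $S$ is parallel if $\nabla S=0$, and an even isomorphism $\varphi$ is parallel with respect to $\nabla^1$ and $\nabla^2$ if $\nabla^2_X\varphi(S)=\varphi(\nabla^1_XS)$ for all super vector fields $X$ and sections $S$. A $\mathcal P$-point $t_0\in I^{\mathcal P}$ is a $\mathcal P$-linear supermorphism $t_0:\{0\}\to I$ (equivalently, an element $t_0\in\mathcal P_0$ with $t_0^\#\in I$); the value at $t_0$ of a section $S$ of $(\mathcal P\otimes\mathcal C_I^\infty)^{p|q}$ is the pullback $S|_{t_0}=t_0^*S\in\mathcal P^{p|q}$. **Theorem 2.12.** Let $I\subset\mathbb R$ be an open interval and $p,q,n\in\mathbb N$. (i) Every $\mathcal P$-super vector bundle on $I^{|n}$ of super rank $(p,q)$ is isomorphic, by an even isomorphism, to the trivial bundle $(\mathcal P\boxtimes(\mathcal C_I^\infty\otimes\bigwedge\mathbb R^n))^{p|q}$. (ii) For every $\mathcal P$-connection $\nabla$ on the trivial bundle $(\mathcal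 P\otimes\mathcal C^\infty_I)^{p|q}$ on $I$ there exists an even automorphism of $(\mathcal P\otimes\mathcal C^\infty_I)^{p|q}$ that is parallel with respect to the trivial connection and $\nabla$. (iii) For every $\mathcal P$-connection $\nabla$ on $(\mathcal P\otimes\mathcal C^\infty_I)^{p|q}$ and every $\mathcal P$-point $t_0\in I^{\mathcal P}$ there exists a unique map $$\tau_{t_0}:\mathcal P^{p|q}\to(\mathcal P\otimes\mathcal C_I^\infty(I))^{p|q}$$ such that $(\tau_{t_0}v)|_{t_0}=v$ and $\nabla(\tau_{t_0}v)=0$ for all $v\in\mathcal P^{p|q}$. This map $\tau_{t_0}$ is $\mathcal P$-linear and even. -/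

import Mathlib

open TopologicalSpace
open scoped Manifold ContDiff TensorProduct

universe u v

/-! ### Small algebras -/

/-- The sign `(-1)^{ij}` of the sign rule, for parities `i`, `j`. -/
def superSign (i j : ZMod 2) : ℤ := ((-1 : ℤˣ) ^ (i * j) : ℤˣ)

theorem superSign_add (i k j : ZMod 2) :
    superSign (i + k) j = superSign k j * superSign i j := by
  rw [superSign, superSign, superSign, add_mul, uzpow_add, Units.val_mul, mul_comm]

/-- A finite-dimensional `ℤ/2`-graded real unital algebra `P = 𝓟 0 ⊕ 𝓟 1` is a *small* algebra if it
is graded commutative and admits a unital algebra projection onto `ℝ` (the body map `#`) whose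
kernel is a nilpotent ideal. -/
class IsSmallAlgebra {P : Type*} [Ring P] [Algebra ℝ P] [FiniteDimensional ℝ P]
    (𝓟 : ZMod 2 → Submodule ℝ P) [GradedAlgebra 𝓟] : Prop where
  /-- `a b = (-1)^{|a||b|} b a` for homogeneous `a`, `b` -/
  mul_comm_super : ∀ (i j : ZMod 2) (a b : P), a ∈ 𝓟 i → b ∈ 𝓟 j →
    a * b = superSign i j • (b * a)
  exists_body : ∃ body : P →ₐ[ℝ] ℝ, IsNilpotent (RingHom.ker body)

/-! ### The graded tensor product `P ⊠ Λℝⁿ` -/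

section SuperTensor

variable {A B : Type*} [Ring A] [Ring B] [Algebra ℝ A] [Algebra ℝ B]
variable (𝒜 : ZMod 2 → Submodule ℝ A) (ℬ : ZMod 2 → Submodule ℝ B)
variable [GradedAlgebra 𝒜] [GradedAlgebra ℬ]

/-- The total parity on the graded tensor product `A ⊠ B`: the part of parity `k` is spanned by the
`a ⊗ b` with `|a| + |b| = k`. -/
noncomputable def totalParity (k : ZMod 2) : Submodule ℝ (𝒜 ᵍ⊗[ℝ] ℬ) :=
  Submodule.span ℝ {x | ∃ i j : ZMod 2, i + j = k ∧ ∃ a ∈ 𝒜 i, ∃ b ∈ ℬ j,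
    x = GradedTensorProduct.tmul ℝ a b}

theorem tmul_mem_totalParity {i j : ZMod 2} {a : A} {b : B} (ha : a ∈ 𝒜 i) (hb : b ∈ ℬ j) :
    (GradedTensorProduct.tmul ℝ a b : 𝒜 ᵍ⊗[ℝ] ℬ) ∈ totalParity 𝒜 ℬ (i + j) :=
  Submodule.subset_span ⟨i, j, rfl, a, ha, b, hb, rfl⟩

/-- The projection of `A ⊠ B` onto its part of parity `k`. -/
noncomputable def totalProj (k : ZMod 2) : (𝒜 ᵍ⊗[ℝ] ℬ) →ₗ[ℝ] (𝒜 ᵍ⊗[ℝ] ℬ) :=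
  (GradedTensorProduct.of ℝ 𝒜 ℬ).toLinearMap ∘ₗ
    (∑ i : ZMod 2, TensorProduct.map (GradedAlgebra.proj 𝒜 i) (GradedAlgebra.proj ℬ (k - i))) ∘ₗ
    (GradedTensorProduct.of ℝ 𝒜 ℬ).symm.toLinearMap

theorem totalProj_tmul (k i j : ZMod 2) {a : A} {b : B} (ha : a ∈ 𝒜 i) (hb : b ∈ ℬ j) :
    totalProj 𝒜 ℬ k (GradedTensorProduct.tmul ℝ a b) =
      if i + j = k then GradedTensorProduct.tmul ℝ a b else 0 := by
  have h : totalProj 𝒜 ℬ k (GradedTensorProduct.tmul ℝ a b) =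
      GradedTensorProduct.of ℝ 𝒜 ℬ (∑ i' : ZMod 2,
        (GradedAlgebra.proj 𝒜 i' a) ⊗ₜ[ℝ] (GradedAlgebra.proj ℬ (k - i') b)) := by
    simp [totalProj]
  rw [h, Finset.sum_eq_single i]
  · rw [GradedAlgebra.proj_apply, GradedAlgebra.proj_apply, DirectSum.decompose_of_mem_same 𝒜 ha]
    split_ifs with hk
    · have : k - i = j := by rw [← hk]; ring
      rw [this, DirectSum.decompose_of_mem_same ℬ hb]
    · have : j ≠ k - i := by
        rintro rfl; exact hk (by ring)
      rw [DirectSum.decompose_of_mem_ne ℬ hb this]; simp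
  · intro i' _ hi'
    rw [GradedAlgebra.proj_apply, DirectSum.decompose_of_mem_ne 𝒜 ha (Ne.symm hi')]; simp
  · simp

theorem totalProj_of_mem {k l : ZMod 2} {x : 𝒜 ᵍ⊗[ℝ] ℬ} (hx : x ∈ totalParity 𝒜 ℬ l) :
    totalProj 𝒜 ℬ k x = if l = k then x else 0 := by
  induction hx using Submodule.span_induction with
  | mem x hx =>
    obtain ⟨i, j, rfl, a, ha, b, hb, rfl⟩ := hx
    exact totalProj_tmul 𝒜 ℬ k i j ha hb
  | zero => simp
  | add x y _ _ hx hy => rw [map_add, hx, hy]; split_ifs <;> simp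
  | smul c x _ hx => rw [map_smul, hx]; split_ifs <;> simp

theorem isCompl_totalParity : IsCompl (totalParity 𝒜 ℬ 0) (totalParity 𝒜 ℬ 1) := by
  constructor
  · rw [Submodule.disjoint_def]
    intro x h0 h1
    have e0 := totalProj_of_mem 𝒜 ℬ (k := 0) h0
    have e1 := totalProj_of_mem 𝒜 ℬ (k := 0) h1
    simp only [if_true] at e0
    rw [e0] at e1
    simpa using e1
  · rw [codisjoint_iff, eq_top_iff]
    rintro x -
    have hT : ∀ k : ZMod 2, totalParity 𝒜 ℬ k ≤ totalParity 𝒜 ℬ 0 ⊔ totalParity 𝒜 ℬ 1 := by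
      intro k
      fin_cases k
      · exact le_sup_left
      · exact le_sup_right
    obtain ⟨y, rfl⟩ := (GradedTensorProduct.of ℝ 𝒜 ℬ).surjective x
    induction y using TensorProduct.induction_on with
    | zero => simp
    | add y z hy hz => rw [map_add]; exact add_mem hy hz
    | tmul a b =>
      classical
      rw [← DirectSum.sum_support_decompose 𝒜 a, ← DirectSum.sum_support_decompose ℬ b,
        TensorProduct.sum_tmul, map_sum]
      refine sum_mem fun i _ => ?_
      rw [TensorProduct.tmul_sum, map_sum]
      exact sum_mem fun j _ => hT _
        (tmul_mem_totalParity 𝒜 ℬ (SetLike.coe_mem _) (SetLike.coe_mem _))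

instance totalParity.gradedMonoid : SetLike.GradedMonoid (totalParity 𝒜 ℬ) where
  one_mem := by
    have := tmul_mem_totalParity 𝒜 ℬ (SetLike.GradedOne.one_mem (A := 𝒜))
      (SetLike.GradedOne.one_mem (A := ℬ))
    rwa [add_zero] at this
  mul_mem := by
    intro k l x y hx hy
    induction hx using Submodule.span_induction with
    | zero => simp
    | add x x' _ _ hx hx' => rw [add_mul]; exact add_mem hx hx'
    | smul c x _ hx => rw [smul_mul_assoc]; exact Submodule.smul_mem _ _ hx
    | mem x hx =>
      obtain ⟨i, j, rfl, a, ha, b, hb, rfl⟩ := hx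
      induction hy using Submodule.span_induction with
      | zero => simp
      | add x x' _ _ hx hx' => rw [mul_add]; exact add_mem hx hx'
      | smul c x _ hx => rw [mul_smul_comm]; exact Submodule.smul_mem _ _ hx
      | mem y hy =>
        obtain ⟨i', j', rfl, a', ha', b', hb', rfl⟩ := hy
        have h := GradedTensorProduct.tmul_coe_mul_coe_tmul 𝒜 ℬ a ⟨b, hb⟩ ⟨a', ha'⟩ b'
        simp only at h
        rw [h]
        have hm := tmul_mem_totalParity 𝒜 ℬ (SetLike.GradedMul.mul_mem ha ha')
          (SetLike.GradedMul.mul_mem hb hb')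
        rw [show i + j + (i' + j') = i + i' + (j + j') by ring, Units.smul_def]
        exact zsmul_mem hm _

noncomputable instance totalParity.gradedAlgebra : GradedAlgebra (totalParity 𝒜 ℬ) :=
  { totalParity.gradedMonoid 𝒜 ℬ,
    (((DirectSum.isInternal_submodule_iff_isCompl (totalParity 𝒜 ℬ) (i := 0) (j := 1)
      (by decide) (by
        ext k; simp only [Set.mem_univ, Set.mem_insert_iff, Set.mem_singleton_iff, true_iff]
        revert k; decide)).2
        (isCompl_totalParity 𝒜 ℬ)).chooseDecomposition) with }

instance superTensor_finite [FiniteDimensional ℝ A] [FiniteDimensional ℝ B] :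
    FiniteDimensional ℝ (𝒜 ᵍ⊗[ℝ] ℬ) :=
  Module.Finite.equiv (GradedTensorProduct.of ℝ 𝒜 ℬ)

end SuperTensor

/-- The parity on the exterior algebra `Λℝⁿ`. -/
abbrev exteriorParity (n : ℕ) : ZMod 2 → Submodule ℝ (ExteriorAlgebra ℝ (Fin n → ℝ)) :=
  CliffordAlgebra.evenOdd (0 : QuadraticForm ℝ (Fin n → ℝ))

instance exteriorAlgebra_finite (n : ℕ) :
    FiniteDimensional ℝ (ExteriorAlgebra ℝ (Fin n → ℝ)) :=
  Module.Finite.of_basis (Pi.basisFun ℝ (Fin n)).ExteriorAlgebra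

/-! ### Superfunctions

`X` is a smooth manifold of dimension one (an open interval, below) and `A` a finite-dimensional real
`ℤ/2`-graded algebra with grading `𝒜`. For `A = P` the sheaf of superfunctions is `P ⊗ C^∞_X`, the
structure sheaf of `X` as a `P`-supermanifold, and for `A = P ⊠ Λℝⁿ` it is
`P ⊠ (C^∞_X ⊗ Λℝⁿ)`, the structure sheaf of the `P`-supermanifold `X^{|n}`. -/

section Superfunctions

variable {X : Type} [TopologicalSpace X] [ChartedSpace ℝ X]

/-- The sections over the open set `U` of the sheaf `A ⊗ C^∞_X`: the smooth `A`-valued functions on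
`U`. As `A` is finite-dimensional, smoothness means smoothness of all the real functions `ℓ ∘ f` with
`ℓ` a linear functional on `A`. Addition and multiplication are pointwise. -/
def superFun (A : Type*) [Ring A] [Algebra ℝ A] [FiniteDimensional ℝ A] (U : Opens X) :
    Subalgebra ℝ (U → A) where
  carrier := {f | ∀ ℓ : A →ₗ[ℝ] ℝ, ContMDiff 𝓘(ℝ, ℝ) 𝓘(ℝ, ℝ) ∞ (fun x => ℓ (f x))}
  add_mem' := by
    intro f g hf hg ℓ
    have h : (fun x => ℓ ((f + g) x)) = fun x => ℓ (f x) + ℓ (g x) :=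
      funext fun x => map_add ℓ (f x) (g x)
    rw [h]
    exact ContMDiff.add (hf ℓ) (hg ℓ)
  algebraMap_mem' := by
    intro r ℓ
    exact contMDiff_const (c := ℓ (algebraMap ℝ A r))
  mul_mem' := by
    intro f g hf hg ℓ
    have key : (fun x => ℓ ((f * g) x)) = fun x => ∑ i, ∑ j,
        (Module.finBasis ℝ A).coord i (f x) * (Module.finBasis ℝ A).coord j (g x) *
          ℓ (Module.finBasis ℝ A i * Module.finBasis ℝ A j) := by
      funext x
      conv_lhs => rw [Pi.mul_apply, ← (Module.finBasis ℝ A).sum_repr (f x),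
        ← (Module.finBasis ℝ A).sum_repr (g x), Finset.sum_mul_sum, map_sum]
      refine Finset.sum_congr rfl fun i _ => ?_
      rw [map_sum]
      refine Finset.sum_congr rfl fun j _ => ?_
      simp only [smul_mul_smul_comm, map_smul, smul_eq_mul, Module.Basis.coord_apply]
    rw [key]
    refine contMDiff_finsetSum fun i _ => contMDiff_finsetSum fun j _ => ?_
    exact ((hf _).mul (hg _)).mul contMDiff_const

variable {A : Type*} [Ring A] [Algebra ℝ A] [FiniteDimensional ℝ A]

namespace superFun

/-- Restriction of superfunctions to a smaller open set. -/
def res {U V : Opens X} (h : U ≤ V) : superFun A V →ₐ[ℝ] superFun A U where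
  toFun f := ⟨fun x => f.1 ⟨x.1, h x.2⟩, fun ℓ => (f.2 ℓ).comp (contMDiff_inclusion h)⟩
  map_one' := rfl
  map_mul' _ _ := rfl
  map_zero' := rfl
  map_add' _ _ := rfl
  commutes' _ := rfl

/-- The constant superfunctions. -/
def const (U : Opens X) : A →ₐ[ℝ] superFun A U where
  toFun a := ⟨fun _ => a, fun _ => contMDiff_const⟩
  map_one' := rfl
  map_mul' _ _ := rfl
  map_zero' := rfl
  map_add' _ _ := rfl
  commutes' _ := rfl

@[simp]
theorem res_apply {U V : Opens X} (h : U ≤ V) (f : superFun A V) (x : U) :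
    (res h f).1 x = f.1 ⟨x.1, h x.2⟩ := rfl

@[simp]
theorem const_apply (U : Opens X) (a : A) (x : U) : (const U a).1 x = a := rfl

variable (𝒜 : ZMod 2 → Submodule ℝ A)

/-- The superfunctions of parity `k`. -/
def par (U : Opens X) (k : ZMod 2) : AddSubgroup (superFun A U) where
  carrier := {f | ∀ x, f.1 x ∈ 𝒜 k}
  add_mem' hf hg x := add_mem (hf x) (hg x)
  zero_mem' _ := zero_mem _
  neg_mem' hf x := neg_mem (hf x)

theorem res_mem {U V : Opens X} (h : U ≤ V) {f : superFun A V} {k : ZMod 2}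
    (hf : f ∈ par 𝒜 V k) : res h f ∈ par 𝒜 U k := fun _ => hf _

variable [GradedAlgebra 𝒜]

theorem mul_mem {U : Opens X} {f g : superFun A U} {i j : ZMod 2}
    (hf : f ∈ par 𝒜 U i) (hg : g ∈ par 𝒜 U j) : f * g ∈ par 𝒜 U (i + j) :=
  fun x => SetLike.GradedMul.mul_mem (hf x) (hg x)

/-- The component of parity `k` of a superfunction. -/
def comp {U : Opens X} (k : ZMod 2) (f : superFun A U) : superFun A U :=
  ⟨fun x => GradedAlgebra.proj 𝒜 k (f.1 x), fun ℓ => f.2 (ℓ ∘ₗ GradedAlgebra.proj 𝒜 k)⟩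

theorem comp_mem {U : Opens X} (k : ZMod 2) (f : superFun A U) : comp 𝒜 k f ∈ par 𝒜 U k :=
  fun _ => SetLike.coe_mem _

theorem comp_add_comp {U : Opens X} (f : superFun A U) : comp 𝒜 0 f + comp 𝒜 1 f = f := by
  classical
  ext x
  have h := DirectSum.sum_support_decompose 𝒜 (f.1 x)
  rw [Finset.sum_subset (Finset.subset_univ _)] at h
  · exact (Fin.sum_univ_two (fun k : Fin 2 => GradedAlgebra.proj 𝒜 k (f.1 x))).symm.trans h
  · intro i _ hi
    simpa using hi

theorem isCompl_par (U : Opens X) : IsCompl (par 𝒜 U 0) (par 𝒜 U 1) := by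
  constructor
  · rw [AddSubgroup.disjoint_def]
    intro f h0 h1
    ext x
    have e0 := DirectSum.decompose_of_mem_same 𝒜 (h0 x)
    rw [DirectSum.decompose_of_mem_ne 𝒜 (h1 x) (by decide)] at e0
    exact e0.symm
  · rw [codisjoint_iff, eq_top_iff]
    intro f _
    rw [← comp_add_comp 𝒜 f]
    exact AddSubgroup.add_mem_sup (comp_mem 𝒜 0 f) (comp_mem 𝒜 1 f)

end superFun

theorem superFun.smooth_ext {U : Opens X} (f : superFun A U) (ℓ : A →ₗ[ℝ] ℝ) (x : U) :
    ContMDiffAt 𝓘(ℝ, ℝ) 𝓘(ℝ, ℝ) ∞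
      (Function.extend (Subtype.val : U → X) (fun y => ℓ (f.1 y)) 0) (x : X) := by
  rw [← contMDiffAt_subtype_iff]
  convert f.2 ℓ x using 2 with y
  exact Subtype.val_injective.extend_apply _ _ y

/-- Superfunctions form a sheaf: compatible local superfunctions glue uniquely. -/
theorem superFun.glue {ι : Type} (W : ι → Opens X) (s : ∀ i, superFun A (W i))
    (hs : ∀ i j, superFun.res (inf_le_left : W i ⊓ W j ≤ W i) (s i) =
      superFun.res (inf_le_right : W i ⊓ W j ≤ W j) (s j)) :
    ∃! t : superFun A (⨆ i, W i), ∀ i, superFun.res (le_iSup W i) t = s i := by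
  have hx : ∀ x : (⨆ i, W i : Opens X), ∃ i, (x : X) ∈ W i := fun x => Opens.mem_iSup.1 x.2
  choose c hc using hx
  have key : ∀ (x : (⨆ i, W i : Opens X)) (i : ι) (hi : (x : X) ∈ W i),
      (s (c x)).1 ⟨x, hc x⟩ = (s i).1 ⟨x, hi⟩ := fun x i hi =>
    congrFun (congrArg Subtype.val (hs (c x) i)) ⟨x, hc x, hi⟩
  refine ⟨⟨fun x => (s (c x)).1 ⟨x, hc x⟩, fun ℓ x => ?_⟩, fun i => ?_, fun t ht => ?_⟩
  · have h := superFun.smooth_ext (s (c x)) ℓ ⟨x, hc x⟩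
    rw [← contMDiffAt_subtype_iff (U := ⨆ i, W i) (x := x)] at h
    refine h.congr_of_eventuallyEq ?_
    have hopen : IsOpen {y : (⨆ i, W i : Opens X) | (y : X) ∈ W (c x)} :=
      (W (c x)).isOpen.preimage continuous_subtype_val
    filter_upwards [hopen.mem_nhds (hc x)] with y hy
    rw [key y (c x) hy]
    exact (Subtype.val_injective.extend_apply (fun z => ℓ ((s (c x)).1 z)) 0
      (⟨y.1, hy⟩ : W (c x))).symm
  · ext x
    exact key ⟨x.1, le_iSup W i x.2⟩ i x.2
  · ext x
    exact congrFun (congrArg Subtype.val (ht (c x))) ⟨x, hc x⟩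

end Superfunctions

/-! ### Super vector bundles -/

section Bundles

/-- A sheaf of graded modules over the sheaf of superfunctions `A ⊗ C^∞_X`. -/
structure SuperModuleSheaf (X : Type) [TopologicalSpace X] [ChartedSpace ℝ X] {A : Type u}
    [Ring A] [Algebra ℝ A] [FiniteDimensional ℝ A] (𝒜 : ZMod 2 → Submodule ℝ A) where
  /-- sections over an open set -/
  sec : Opens X → Type v
  [addCommGroup : ∀ U, AddCommGroup (sec U)]
  [module : ∀ U, Module (superFun A U) (sec U)]
  /-- sections of parity `k` over an open set -/
  par : ∀ U, ZMod 2 → AddSubgroup (sec U)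
  /-- restriction of sections -/
  res : ∀ {U V : Opens X}, U ≤ V → sec V →+ sec U
  res_self : ∀ {U : Opens X} (s : sec U), res (le_refl U) s = s
  res_res : ∀ {U V W : Opens X} (h : U ≤ V) (h' : V ≤ W) (s : sec W),
    res h (res h' s) = res (h.trans h') s
  res_smul : ∀ {U V : Opens X} (h : U ≤ V) (f : superFun A V) (s : sec V),
    res h (f • s) = superFun.res h f • res h s
  /-- sheaf condition -/
  glue : ∀ {ι : Type} (W : ι → Opens X) (s : ∀ i, sec (W i)),
    (∀ i j, res (inf_le_left : W i ⊓ W j ≤ W i) (s i) =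
      res (inf_le_right : W i ⊓ W j ≤ W j) (s j)) →
    ∃! t : sec (⨆ i, W i), ∀ i, res (le_iSup W i) t = s i
  /-- `E = E₀ ⊕ E₁` -/
  isCompl_par : ∀ U, IsCompl (par U 0) (par U 1)
  res_mem : ∀ {U V : Opens X} (h : U ≤ V) {k : ZMod 2} {s : sec V}, s ∈ par V k → res h s ∈ par U k
  smul_mem : ∀ {U : Opens X} {i j : ZMod 2} {f : superFun A U} {s : sec U},
    f ∈ superFun.par 𝒜 U i → s ∈ par U j → f • s ∈ par U (i + j)

attribute [instance] SuperModuleSheaf.addCommGroup SuperModuleSheaf.module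

variable {X : Type} [TopologicalSpace X] [ChartedSpace ℝ X]
variable {A : Type*} [Ring A] [Algebra ℝ A] [FiniteDimensional ℝ A]
variable {𝒜 : ZMod 2 → Submodule ℝ A}

/-- The parity of the standard frame `e_1, …, e_p` (even), `f_1, …, f_q` (odd). -/
def frameParity {p q : ℕ} : Fin p ⊕ Fin q → ZMod 2 :=
  Sum.elim (fun _ => 0) (fun _ => 1)

/-- The elements of parity `k` of `P^{p|q}`: the first `p` components have parity `k`, the last `q`
ones have parity `k + 1`. -/
def freePar (𝒜 : ZMod 2 → Submodule ℝ A) (p q : ℕ) (k : ZMod 2) :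
    AddSubgroup (Fin p ⊕ Fin q → A) where
  carrier := {v | ∀ l, v l ∈ 𝒜 (k + frameParity l)}
  add_mem' hf hg l := add_mem (hf l) (hg l)
  zero_mem' _ := zero_mem _
  neg_mem' hf l := neg_mem (hf l)

variable (X 𝒜) in
/-- The trivial super vector bundle `(A ⊗ C^∞_X)^{p|q}`. -/
@[reducible]
def trivialBundle [GradedAlgebra 𝒜] (p q : ℕ) : SuperModuleSheaf X 𝒜 where
  sec U := Fin p ⊕ Fin q → superFun A U
  par U k :=
    { carrier := {s | ∀ l, s l ∈ superFun.par 𝒜 U (k + frameParity l)}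
      add_mem' := fun hf hg l => add_mem (hf l) (hg l)
      zero_mem' := fun _ => zero_mem _
      neg_mem' := fun hf l => neg_mem (hf l) }
  res h :=
    { toFun := fun s l => superFun.res h (s l)
      map_zero' := rfl
      map_add' := fun _ _ => rfl }
  res_self _ := rfl
  res_res _ _ _ := rfl
  res_smul _ _ _ := rfl
  glue W s hs := by
    have h := fun l => superFun.glue W (fun i => s i l) (fun i j => congrFun (hs i j) l)
    choose t ht hu using h
    exact ⟨t, fun i => funext fun l => ht l i,
      fun t' ht' => funext fun l => hu l (t' l) fun i => congrFun (ht' i) l⟩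
  isCompl_par U := by
    have hc : ∀ k : ZMod 2, IsCompl (superFun.par (X := X) 𝒜 U (0 + k))
        (superFun.par 𝒜 U (1 + k)) := by
      intro k
      fin_cases k
      · exact superFun.isCompl_par 𝒜 U
      · exact (superFun.isCompl_par 𝒜 U).symm
    constructor
    · rw [AddSubgroup.disjoint_def]
      intro s h0 h1
      funext l
      exact AddSubgroup.disjoint_def.1 (hc (frameParity l)).disjoint (h0 l) (h1 l)
    · rw [codisjoint_iff, eq_top_iff]
      intro s _
      have h : ∀ l, ∃ y ∈ superFun.par (X := X) 𝒜 U (0 + frameParity l),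
          ∃ z ∈ superFun.par 𝒜 U (1 + frameParity l), y + z = s l := by
        intro l
        have hl : s l ∈ (⊤ : AddSubgroup (superFun A U)) := trivial
        rw [← codisjoint_iff.1 (hc (frameParity l)).codisjoint] at hl
        exact AddSubgroup.mem_sup.1 hl
      choose y hy z hz hyz using h
      exact AddSubgroup.mem_sup.2 ⟨y, hy, z, hz, funext hyz⟩
  res_mem h _ _ hs l := superFun.res_mem 𝒜 h (hs l)
  smul_mem := by
    intro U i j f s hf hs l
    rw [add_assoc]
    exact superFun.mul_mem 𝒜 hf (hs l)

/-- An even isomorphism `E|_W ≃ F|_W` of sheaves of graded modules. -/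
structure SuperIso (E : SuperModuleSheaf X 𝒜) (F : SuperModuleSheaf X 𝒜) (W : Opens X) where
  toEquiv : ∀ U : Opens X, U ≤ W → (E.sec U ≃ₗ[superFun A U] F.sec U)
  map_res : ∀ {U V : Opens X} (h : U ≤ V) (hV : V ≤ W) (s : E.sec V),
    toEquiv U (h.trans hV) (E.res h s) = F.res h (toEquiv V hV s)
  map_par : ∀ {U : Opens X} (hU : U ≤ W) {k : ZMod 2} {s : E.sec U},
    s ∈ E.par U k → toEquiv U hU s ∈ F.par U k

/-- `E` is a super vector bundle of super rank `(p, q)`: it is locally isomorphic to the trivial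
bundle. -/
def IsSuperVectorBundle [GradedAlgebra 𝒜] (E : SuperModuleSheaf X 𝒜) (p q : ℕ) : Prop :=
  ∀ x : X, ∃ W : Opens X, x ∈ W ∧ Nonempty (SuperIso E (trivialBundle X 𝒜 p q) W)

end Bundles

/-! ### Super vector fields, connections, parallel transport

Here `P` is a small algebra, and `X` is regarded as a `P`-supermanifold (of super dimension `(1, 0)`)
with structure sheaf `P ⊗ C^∞_X`. -/

section Connections

variable {X : Type} [TopologicalSpace X] [ChartedSpace ℝ X]
variable {P : Type*} [Ring P] [Algebra ℝ P] [FiniteDimensional ℝ P]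
variable {𝓟 : ZMod 2 → Submodule ℝ P}

variable (P) in
/-- Families of maps, one on the superfunctions on each open subset of `U`. -/
def LocalOperator (U : Opens X) : Type _ :=
  ∀ V : {V : Opens X // V ≤ U}, superFun P V.1 → superFun P V.1

instance (U : Opens X) : AddCommGroup (LocalOperator P U) :=
  inferInstanceAs (AddCommGroup (∀ V : {V : Opens X // V ≤ U}, superFun P V.1 → superFun P V.1))

/-- `(f D) g = f (D g)`. -/
instance (U : Opens X) : Module (superFun P U) (LocalOperator P U) where
  smul f D := fun V g => superFun.res V.2 f * D V g
  one_smul D := by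
    funext V g
    exact (congrArg (· * D V g) (map_one (superFun.res V.2))).trans (one_mul _)
  mul_smul f f' D := by
    funext V g
    exact (congrArg (· * D V g) (map_mul (superFun.res V.2) f f')).trans (mul_assoc _ _ _)
  smul_zero f := by
    funext V g
    exact mul_zero (superFun.res V.2 f)
  zero_smul D := by
    funext V g
    exact (congrArg (· * D V g) (map_zero (superFun.res V.2))).trans (zero_mul _)
  smul_add f D D' := by
    funext V g
    exact mul_add (superFun.res V.2 f) (D V g) (D' V g)
  add_smul f f' D := by
    funext V g
    exact (congrArg (· * D V g) (map_add (superFun.res V.2) f f')).trans (add_mul _ _ _)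

/-- Restriction to a smaller open set. -/
def LocalOperator.res {U V : Opens X} (h : U ≤ V) (D : LocalOperator P V) : LocalOperator P U :=
  fun W => D ⟨W.1, W.2.trans h⟩

variable (𝓟) in
/-- `D` is a `P`-linear super derivation of parity `k` of the sheaf `(P ⊗ C^∞_X)|_U`. -/
structure IsSuperDerivation {U : Opens X} (k : ZMod 2) (D : LocalOperator P U) : Prop where
  map_res : ∀ {V W : Opens X} (h : V ≤ W) (hW : W ≤ U) (g : superFun P W),
    D ⟨V, (h.trans hW)⟩ (superFun.res h g) = superFun.res h (D ⟨W, hW⟩ g)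
  map_par : ∀ {V : Opens X} (hV : V ≤ U) {j : ZMod 2} {g : superFun P V},
    g ∈ superFun.par 𝓟 V j → D ⟨V, hV⟩ g ∈ superFun.par 𝓟 V (k + j)
  map_add : ∀ {V : Opens X} (hV : V ≤ U) (g g' : superFun P V),
    D ⟨V, hV⟩ (g + g') = D ⟨V, hV⟩ g + D ⟨V, hV⟩ g'
  /-- `D (c g) = (-1)^{|D||c|} c (D g)` for `c ∈ P` homogeneous -/
  map_const_mul : ∀ {V : Opens X} (hV : V ≤ U) {j : ZMod 2} {c : P} (g : superFun P V), c ∈ 𝓟 j →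
    D ⟨V, hV⟩ (superFun.const V c * g) = superSign k j • (superFun.const V c * D ⟨V, hV⟩ g)
  /-- `D (f g) = (D f) g + (-1)^{|D||f|} f (D g)` for `f` homogeneous -/
  leibniz : ∀ {V : Opens X} (hV : V ≤ U) {j : ZMod 2} {f : superFun P V} (g : superFun P V),
    f ∈ superFun.par 𝓟 V j →
    D ⟨V, hV⟩ (f * g) = D ⟨V, hV⟩ f * g + superSign k j • (f * D ⟨V, hV⟩ g)

theorem IsSuperDerivation.zero {U : Opens X} (k : ZMod 2) :
    IsSuperDerivation 𝓟 k (0 : LocalOperator P U) where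
  map_res h _ _ := (map_zero (superFun.res h)).symm
  map_par _ _ _ _ := zero_mem _
  map_add {V} _ _ _ := (add_zero (0 : superFun P V)).symm
  map_const_mul _ _ _ _ _ := by
    change (0 : superFun P _) = _ • (_ * (0 : superFun P _))
    rw [mul_zero, zsmul_zero]
  leibniz _ _ _ _ _ := by
    change (0 : superFun P _) = 0 * _ + _ • (_ * (0 : superFun P _))
    rw [mul_zero, zsmul_zero, zero_mul, add_zero]

theorem IsSuperDerivation.add {U : Opens X} {k : ZMod 2} {D D' : LocalOperator P U}
    (hD : IsSuperDerivation 𝓟 k D) (hD' : IsSuperDerivation 𝓟 k D') :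
    IsSuperDerivation 𝓟 k (D + D') where
  map_res {V W} h hW g := by
    change D ⟨V, _⟩ _ + D' ⟨V, _⟩ _ = superFun.res h (D ⟨W, hW⟩ g + D' ⟨W, hW⟩ g)
    rw [hD.map_res, hD'.map_res, _root_.map_add]
  map_par hV _ _ hg := add_mem (hD.map_par hV hg) (hD'.map_par hV hg)
  map_add {V} hV g g' := by
    change D ⟨V, _⟩ _ + D' ⟨V, _⟩ _ = (D ⟨V, _⟩ _ + D' ⟨V, _⟩ _) + (D ⟨V, _⟩ _ + D' ⟨V, _⟩ _)
    rw [hD.map_add, hD'.map_add, add_add_add_comm]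
  map_const_mul {V} hV _ _ g hc := by
    change D ⟨V, _⟩ _ + D' ⟨V, _⟩ _ = _ • (_ * (D ⟨V, _⟩ _ + D' ⟨V, _⟩ _))
    rw [hD.map_const_mul hV g hc, hD'.map_const_mul hV g hc, mul_add, zsmul_add]
  leibniz {V} hV _ _ g hf := by
    change D ⟨V, _⟩ _ + D' ⟨V, _⟩ _ = (D ⟨V, _⟩ _ + D' ⟨V, _⟩ _) * _ + _ • (_ * (D ⟨V, _⟩ _ + D' ⟨V, _⟩ _))
    rw [hD.leibniz hV g hf, hD'.leibniz hV g hf, mul_add, zsmul_add, add_mul, add_add_add_comm]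

theorem superFun.mul_comm_super [GradedAlgebra 𝓟] [IsSmallAlgebra 𝓟] {U : Opens X} {i j : ZMod 2}
    {f g : superFun P U} (hf : f ∈ superFun.par 𝓟 U i) (hg : g ∈ superFun.par 𝓟 U j) :
    f * g = superSign i j • (g * f) := by
  ext x
  have h := IsSmallAlgebra.mul_comm_super i j _ _ (hf x) (hg x)
  exact h

theorem IsSuperDerivation.smul [GradedAlgebra 𝓟] [IsSmallAlgebra 𝓟] {U : Opens X} {i k : ZMod 2}
    {f : superFun P U} {D : LocalOperator P U} (hf : f ∈ superFun.par 𝓟 U i)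
    (hD : IsSuperDerivation 𝓟 k D) : IsSuperDerivation 𝓟 (i + k) (f • D) where
  map_res {V W} h hW g := by
    change superFun.res _ f * D ⟨V, _⟩ _ = superFun.res h (superFun.res _ f * D ⟨W, hW⟩ g)
    rw [hD.map_res, _root_.map_mul]
    rfl
  map_par hV _ _ hg := by
    rw [add_assoc]
    exact superFun.mul_mem 𝓟 (superFun.res_mem 𝓟 hV hf) (hD.map_par hV hg)
  map_add {V} hV g g' := by
    change superFun.res _ f * D ⟨V, _⟩ _ = superFun.res _ f * D ⟨V, _⟩ _ + superFun.res _ f * D ⟨V, _⟩ _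
    rw [hD.map_add, mul_add]
  map_const_mul {V} hV j c g hc := by
    change superFun.res _ f * D ⟨V, _⟩ _ = _ • (_ * (superFun.res _ f * D ⟨V, _⟩ _))
    have hc' : superFun.const V c ∈ superFun.par 𝓟 V j := fun _ => hc
    rw [hD.map_const_mul hV g hc, mul_smul_comm, ← mul_assoc, ← mul_assoc,
      superFun.mul_comm_super (superFun.res_mem 𝓟 hV hf) hc', smul_mul_assoc, smul_smul,
      superSign_add]
  leibniz {V} hV j f' g hf' := by
    change superFun.res _ f * D ⟨V, _⟩ _ =
      (superFun.res _ f * D ⟨V, _⟩ _) * _ + _ • (_ * (superFun.res _ f * D ⟨V, _⟩ _))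
    rw [hD.leibniz hV g hf', mul_add, mul_smul_comm, ← mul_assoc, ← mul_assoc, ← mul_assoc,
      superFun.mul_comm_super (superFun.res_mem 𝓟 hV hf) hf', smul_mul_assoc, smul_smul,
      superSign_add]

variable (𝓟) in
/-- The sections over `U` of the super tangent bundle `sT X`: the `P`-super vector fields on `U`, i.e.
the sums of an even and an odd `P`-linear super derivation of `(P ⊗ C^∞_X)|_U`. -/
def superTangent [GradedAlgebra 𝓟] [IsSmallAlgebra 𝓟] (U : Opens X) :
    Submodule (superFun P U) (LocalOperator P U) where
  carrier := {D | ∃ D₀ D₁, IsSuperDerivation 𝓟 0 D₀ ∧ IsSuperDerivation 𝓟 1 D₁ ∧ D = D₀ + D₁}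
  zero_mem' := ⟨0, 0, IsSuperDerivation.zero 0, IsSuperDerivation.zero 1, (add_zero _).symm⟩
  add_mem' := by
    rintro _ _ ⟨D₀, D₁, h₀, h₁, rfl⟩ ⟨D₀', D₁', h₀', h₁', rfl⟩
    exact ⟨D₀ + D₀', D₁ + D₁', h₀.add h₀', h₁.add h₁', add_add_add_comm _ _ _ _⟩
  smul_mem' := by
    rintro f _ ⟨D₀, D₁, h₀, h₁, rfl⟩
    refine ⟨superFun.comp 𝓟 0 f • D₀ + superFun.comp 𝓟 1 f • D₁,
      superFun.comp 𝓟 0 f • D₁ + superFun.comp 𝓟 1 f • D₀,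
      (IsSuperDerivation.smul (superFun.comp_mem 𝓟 0 f) h₀).add
        (by exact IsSuperDerivation.smul (i := 1) (k := 1) (superFun.comp_mem 𝓟 1 f) h₁),
      (IsSuperDerivation.smul (i := 0) (k := 1) (superFun.comp_mem 𝓟 0 f) h₁).add
        (IsSuperDerivation.smul (i := 1) (k := 0) (superFun.comp_mem 𝓟 1 f) h₀), ?_⟩
    conv_lhs => rw [← superFun.comp_add_comp 𝓟 f]
    rw [add_smul, smul_add, smul_add]
    abel

variable [GradedAlgebra 𝓟] [IsSmallAlgebra 𝓟]

/-- Restriction of super vector fields to a smaller open set. -/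
def superTangent.res {U V : Opens X} (h : U ≤ V) (D : superTangent 𝓟 V) : superTangent 𝓟 U :=
  ⟨D.1.res h, by
    obtain ⟨D₀, D₁, h₀, h₁, hD⟩ := D.2
    refine ⟨D₀.res h, D₁.res h, ?_, ?_, by rw [hD]; rfl⟩
    · exact ⟨fun a b => h₀.map_res a (b.trans h), fun a => h₀.map_par (a.trans h),
        fun a => h₀.map_add (a.trans h), fun a => h₀.map_const_mul (a.trans h),
        fun a => h₀.leibniz (a.trans h)⟩
    · exact ⟨fun a b => h₁.map_res a (b.trans h), fun a => h₁.map_par (a.trans h),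
        fun a => h₁.map_add (a.trans h), fun a => h₁.map_const_mul (a.trans h),
        fun a => h₁.leibniz (a.trans h)⟩⟩

/-- A `P`-connection on `E`: an even `P`-linear sheaf morphism `∇ : E → sT^*X ⊠ E` satisfying the
Leibniz rule `∇(f S) = df ⊗ S + f ∇S`. A section `Ω` of `sT^*X ⊠ E` is given by the left linear map
`D ↦ ⟨D, Ω⟩` on super vector fields, where `⟨D, ω ⊗ S⟩ = ⟨D, ω⟩ S`, `⟨D, df⟩ = D f` and
`⟨D, f Ω⟩ = (-1)^{|D||f|} f ⟨D, Ω⟩`; thus `∇ U S D` is the covariant derivative `∇_D S`. -/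
structure SuperConnection (E : SuperModuleSheaf X 𝓟) where
  toFun : ∀ U : Opens X, E.sec U →+ (superTangent 𝓟 U →ₗ[superFun P U] E.sec U)
  map_res : ∀ {U V : Opens X} (h : U ≤ V) (S : E.sec V) (D : superTangent 𝓟 V),
    toFun U (E.res h S) (superTangent.res h D) = E.res h (toFun V S D)
  map_par : ∀ {U : Opens X} {i k : ZMod 2} {S : E.sec U} {D : superTangent 𝓟 U}, S ∈ E.par U i →
    IsSuperDerivation 𝓟 k D.1 → toFun U S D ∈ E.par U (k + i)
  map_const_smul : ∀ {U : Opens X} {j k : ZMod 2} {c : P} (S : E.sec U) {D : superTangent 𝓟 U},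
    c ∈ 𝓟 j → IsSuperDerivation 𝓟 k D.1 →
    toFun U (superFun.const U c • S) D = superSign k j • (superFun.const U c • toFun U S D)
  leibniz : ∀ {U : Opens X} {j k : ZMod 2} {f : superFun P U} (S : E.sec U) {D : superTangent 𝓟 U},
    f ∈ superFun.par 𝓟 U j → IsSuperDerivation 𝓟 k D.1 →
    toFun U (f • S) D = (D.1 ⟨U, le_rfl⟩ f) • S + superSign k j • (f • toFun U S D)

/-- A global section `S` is parallel: `∇S = 0`. -/
def SuperConnection.IsParallelSection {E : SuperModuleSheaf X 𝓟} (nabla : SuperConnection E)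
    (S : E.sec ⊤) : Prop :=
  ∀ U : Opens X, nabla.toFun U (E.res le_top S) = 0

/-- An even isomorphism `φ : E → F` is parallel: `∇^F_D φ(S) = φ(∇^E_D S)`. -/
def SuperIso.IsParallel {E : SuperModuleSheaf X 𝓟} {F : SuperModuleSheaf X 𝓟} (φ : SuperIso E F ⊤)
    (nablaE : SuperConnection E) (nablaF : SuperConnection F) : Prop :=
  ∀ (U : Opens X) (S : E.sec U) (D : superTangent 𝓟 U),
    nablaF.toFun U (φ.toEquiv U le_top S) D = φ.toEquiv U le_top (nablaE.toFun U S D)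

theorem superTangent.map_add {U : Opens X} (D : superTangent 𝓟 U) (g g' : superFun P U) :
    D.1 ⟨U, le_rfl⟩ (g + g') = D.1 ⟨U, le_rfl⟩ g + D.1 ⟨U, le_rfl⟩ g' := by
  obtain ⟨_, D₀, D₁, h₀, h₁, rfl⟩ := D
  change D₀ ⟨U, _⟩ _ + D₁ ⟨U, _⟩ _ = (D₀ ⟨U, _⟩ _ + D₁ ⟨U, _⟩ _) + (D₀ ⟨U, _⟩ _ + D₁ ⟨U, _⟩ _)
  rw [h₀.map_add, h₁.map_add, add_add_add_comm]

theorem superTangent.map_res {U V : Opens X} (h : U ≤ V) (D : superTangent 𝓟 V)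
    (g : superFun P V) :
    D.1 ⟨U, h⟩ (superFun.res h g) = superFun.res h (D.1 ⟨V, le_rfl⟩ g) := by
  obtain ⟨_, D₀, D₁, h₀, h₁, rfl⟩ := D
  change D₀ ⟨U, _⟩ _ + D₁ ⟨U, _⟩ _ = superFun.res h (D₀ ⟨V, _⟩ _ + D₁ ⟨V, _⟩ _)
  rw [_root_.map_add, ← h₀.map_res, ← h₁.map_res]

variable (X 𝓟) in
/-- The trivial connection on the trivial bundle: `∇_D (S^k e_k) = (D S^k) e_k`. -/
def trivialConnection (p q : ℕ) : SuperConnection (trivialBundle X 𝓟 p q) where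
  toFun U :=
    { toFun := fun S =>
        { toFun := fun D l => D.1 ⟨U, le_rfl⟩ (S l)
          map_add' := fun _ _ => rfl
          map_smul' := fun _ _ => rfl }
      map_zero' := by
        ext1 D
        funext l
        have h := superTangent.map_add D 0 0
        rw [add_zero] at h
        exact left_eq_add.1 h
      map_add' := fun S T => by
        ext1 D
        funext l
        exact superTangent.map_add D (S l) (T l) }
  map_res h S D := funext fun l => superTangent.map_res h D (S l)
  map_par hS hD l := by
    rw [add_assoc]
    exact hD.map_par le_rfl (hS l)
  map_const_smul S _ hc hD := funext fun l => hD.map_const_mul le_rfl (S l) hc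
  leibniz S _ hf hD := funext fun l => hD.leibniz le_rfl (S l) hf

variable (X 𝓟) in
/-- A `P`-point of `X`: a morphism of `P`-supermanifolds `{0} → X`, i.e. a point `pt` of `X` (the
image of `0`) together with even unital `P`-linear algebra homomorphisms
`(P ⊗ C^∞_X)(U) → P`, for `U` an open neighbourhood of `pt`, compatible with restriction. -/
structure SuperPoint where
  pt : X
  pullback : ∀ U : Opens X, pt ∈ U → (superFun P U →+* P)
  map_res : ∀ {U V : Opens X} (h : U ≤ V) (hU : pt ∈ U) (f : superFun P V),
    pullback U hU (superFun.res h f) = pullback V (h hU) f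
  map_const_mul : ∀ {U : Opens X} (hU : pt ∈ U) (c : P) (f : superFun P U),
    pullback U hU (superFun.const U c * f) = c * pullback U hU f
  map_par : ∀ {U : Opens X} (hU : pt ∈ U) {k : ZMod 2} {f : superFun P U},
    f ∈ superFun.par 𝓟 U k → pullback U hU f ∈ 𝓟 k

/-- The value `S(t₀) ∈ P^{p|q}` of a global section `S` of the trivial bundle at a `P`-point. -/
def SuperPoint.eval (t₀ : SuperPoint X 𝓟) {p q : ℕ} (S : (trivialBundle X 𝓟 p q).sec ⊤) :
    Fin p ⊕ Fin q → P :=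
  fun l => t₀.pullback ⊤ trivial (S l)

end Connections

/-! A superfunction is a smooth function of one real variable with values in a finite-dimensional
graded algebra `A`: `A = P` for connections, `A = P ⊠ Λℝⁿ` for bundles on `I^{|n}`, the odd
coordinates being absorbed into the coefficients. In a frame, sections are row vectors of such
functions, and everything reduces to linear matrix differential equations over `A`. Their solutions
exist on the whole interval by the Dyson series (`exists_hasDerivAt_linear`). The main tool is
`exists_fundamental`: for an even matrix `Γ` there is an even invertible `G` with `G' = -GΓ`.
Evenness is obtained by projection, since the even part of a solution is again a solution.

Connections: by Hadamard's lemma every super vector field is a multiple of `d/dt`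
(`superTangent.eq_smul_partialT`), so a connection is determined by `∇S = S' + SΓ` along `d/dt`. The
equation for `G` gives `∇(SG) = S'G`, so right multiplication by `G` carries the trivial connection
to `∇`. Hence the parallel sections are the `cG` with `c` a constant row. At a `P`-point `t₀` such a
section has the value `c G(t₀)`, and `G(t₀)` is invertible because pullback is a ring homomorphism.
So a prescribed value `v` forces `c = v G(t₀)⁻¹`, an expression that is `P`-linear and even in `v`.

Bundles: local trivializations are frames, and two frames differ on an overlap by an even invertible
matrix `g`. Cutting off `g` would destroy invertibility, but its logarithmic derivative `Γ = -g⁻¹g'`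
may be cut off freely. The fundamental solution `G` of the cut-off equation is defined on all of
`I`, and `g = cG` on a smaller interval with `c` constant. Thus `cG` extends `g`, and one frame can
be altered to agree with the other (`IsFrame.exists_modification`). Chaining frames along a compact
interval, then along an exhaustion of `I`, yields a global frame. -/

set_option linter.unusedSectionVars false

/-! ### Differentiation of superfunctions on an interval -/

namespace superFun

variable {I : Opens ℝ} {A : Type*} [Ring A] [Algebra ℝ A] [FiniteDimensional ℝ A]
variable {U V : Opens I}

/-- The inclusion of an open subset of `I` into the real line. -/
def toReal (U : Opens I) (x : U) : ℝ := ((x : I) : ℝ)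

theorem isOpenEmbedding_toReal (U : Opens I) : Topology.IsOpenEmbedding (toReal U) :=
  I.isOpenEmbedding'.comp U.isOpenEmbedding'

theorem toReal_injective (U : Opens I) : Function.Injective (toReal U) :=
  (isOpenEmbedding_toReal U).injective

/-- The extension by zero of a function on an open subset of `I` to the real line. -/
noncomputable def ambient {M : Type*} [Zero M] (f : U → M) : ℝ → M := Function.extend (toReal U) f 0

@[simp]
theorem ambient_apply {M : Type*} [Zero M] (f : U → M) (x : U) : ambient f (toReal U x) = f x :=
  (toReal_injective U).extend_apply _ _ _

theorem eventually_toReal {p : ℝ → Prop} (x : U) (h : ∀ᶠ y in nhds x, p (toReal U y)) :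
    ∀ᶠ t in nhds (toReal U x), p t := by
  rw [← (isOpenEmbedding_toReal U).map_nhds_eq]
  exact h

/-- `U` is an open subset of the open subset `I` of `ℝ`; neither of the two inclusions affects
smoothness at a point. -/
theorem contMDiffAt_iff (g : ℝ → ℝ) (x : U) :
    ContMDiffAt 𝓘(ℝ, ℝ) 𝓘(ℝ, ℝ) ∞ (fun y : U => g (toReal U y)) x ↔
      ContDiffAt ℝ ∞ g (toReal U x) := by
  rw [← contMDiffAt_iff_contDiffAt]
  exact (contMDiffAt_subtype_iff (U := U) (f := fun y : I => g y) (x := x)).trans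
    (contMDiffAt_subtype_iff (U := I) (f := g) (x := (x : I)))

theorem contMDiff_iff (f : U → ℝ) :
    ContMDiff 𝓘(ℝ, ℝ) 𝓘(ℝ, ℝ) ∞ f ↔ ∀ x : U, ContDiffAt ℝ ∞ (ambient f) (toReal U x) := by
  refine forall_congr' fun x => ?_
  rw [← contMDiffAt_iff]
  simp only [ambient_apply]

theorem linear_ambient {M : Type*} [AddCommGroup M] [Module ℝ M] (f : U → M) (ℓ : M →ₗ[ℝ] ℝ) :
    ambient (fun y => ℓ (f y)) = fun t => ℓ (ambient f t) := by
  funext t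
  by_cases h : ∃ x, toReal U x = t
  · obtain ⟨x, rfl⟩ := h
    simp
  · simp [ambient, Function.extend_apply' _ _ _ h]

theorem contDiffAt_ambient (f : superFun A U) (ℓ : A →ₗ[ℝ] ℝ) (x : U) :
    ContDiffAt ℝ ∞ (fun t => ℓ (ambient f.1 t)) (toReal U x) := by
  rw [← linear_ambient]
  exact (contMDiff_iff _).1 (f.2 ℓ) x

/-- The superfunction on `U` given by a function on the real line that is smooth on `U`. -/
def ofReal (F : ℝ → A) (hF : ∀ (ℓ : A →ₗ[ℝ] ℝ) (x : U),
    ContDiffAt ℝ ∞ (fun t => ℓ (F t)) (toReal U x)) : superFun A U :=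
  ⟨fun x => F (toReal U x), fun ℓ x => (contMDiffAt_iff (fun t => ℓ (F t)) x).2 (hF ℓ x)⟩

/-- The underlying function of the derivative of a superfunction. -/
noncomputable def derFun (f : superFun A U) (t : ℝ) : A :=
  ∑ i, deriv (fun s => (Module.finBasis ℝ A).coord i (ambient f.1 s)) t • Module.finBasis ℝ A i

theorem linear_eq_sum_coord (ℓ : A →ₗ[ℝ] ℝ) (a : A) :
    ℓ a = ∑ i, (Module.finBasis ℝ A).coord i a * ℓ (Module.finBasis ℝ A i) := by
  conv_lhs => rw [← (Module.finBasis ℝ A).sum_repr a, map_sum]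
  simp

theorem contDiffAt_deriv {g : ℝ → ℝ} {t : ℝ} (h : ContDiffAt ℝ ∞ g t) :
    ContDiffAt ℝ ∞ (deriv g) t :=
  (h.fderiv_right (m := ∞) (by simp)).clm_apply contDiffAt_const

/-- The derivative `f ↦ f'` of superfunctions. -/
noncomputable def derAux (f : superFun A U) : superFun A U :=
  ofReal (derFun f) fun ℓ x => by
    have : (fun t => ℓ (derFun f t)) = fun t => ∑ i,
        deriv (fun s => (Module.finBasis ℝ A).coord i (ambient f.1 s)) t *
          ℓ (Module.finBasis ℝ A i) := by
      funext t
      simp [derFun]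
    rw [this]
    refine ContDiffAt.sum fun i _ => ContDiffAt.mul ?_ contDiffAt_const
    exact contDiffAt_deriv (contDiffAt_ambient f _ x)

theorem hasDerivAt_derAux (f : superFun A U) (ℓ : A →ₗ[ℝ] ℝ) (x : U) :
    HasDerivAt (fun t => ℓ (ambient f.1 t)) (ℓ ((derAux f).1 x)) (toReal U x) := by
  have h : ∀ i, HasDerivAt (fun s => (Module.finBasis ℝ A).coord i (ambient f.1 s))
      (deriv (fun s => (Module.finBasis ℝ A).coord i (ambient f.1 s)) (toReal U x))
      (toReal U x) := fun i =>
    ((contDiffAt_ambient f _ x).differentiableAt (by simp)).hasDerivAt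
  have h' := HasDerivAt.fun_sum fun i (_ : i ∈ Finset.univ) =>
    (h i).mul_const (ℓ (Module.finBasis ℝ A i))
  rw [funext fun t => linear_eq_sum_coord ℓ (ambient f.1 t)]
  refine h'.congr_deriv ?_
  change _ = ℓ (derFun f _)
  simp [derFun]

theorem eq_of_forall_linear {M : Type*} [AddCommGroup M] [Module ℝ M] {a b : M}
    (h : ∀ ℓ : M →ₗ[ℝ] ℝ, ℓ a = ℓ b) : a = b := by
  rw [← sub_eq_zero, ← Module.forall_dual_apply_eq_zero_iff ℝ]
  intro ℓ
  rw [map_sub, h, sub_self]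

/-- Linear functionals separate the points of `A`, and real derivatives are unique. This turns every
identity for the derivative into a statement about real functions. -/
theorem derAux_eq (f g : superFun A U) (h : ∀ (ℓ : A →ₗ[ℝ] ℝ) (x : U),
    HasDerivAt (fun t => ℓ (ambient f.1 t)) (ℓ (g.1 x)) (toReal U x)) : derAux f = g := by
  ext x
  exact eq_of_forall_linear fun ℓ => (hasDerivAt_derAux f ℓ x).unique (h ℓ x)

theorem hasDerivAt_congr {M : Type*} [AddCommGroup M] [Module ℝ M] {f : U → M} {F : ℝ → ℝ}
    (ℓ : M →ₗ[ℝ] ℝ) {x : U} {v : ℝ}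
    (h : HasDerivAt F v (toReal U x)) (hF : ∀ y, F (toReal U y) = ℓ (f y)) :
    HasDerivAt (fun t => ℓ (ambient f t)) v (toReal U x) := by
  refine h.congr_of_eventuallyEq ?_
  refine eventually_toReal x (.of_forall fun y => ?_)
  simp [hF]

/-- The derivation `d/dt` of the algebra of superfunctions. -/
noncomputable def der (U : Opens I) : superFun A U →+ superFun A U where
  toFun := derAux
  map_zero' := derAux_eq _ _ fun ℓ x => by
    refine hasDerivAt_congr ℓ (F := fun _ => 0) (v := ℓ 0) ?_ fun y => (map_zero ℓ).symm
    simpa using hasDerivAt_const (toReal U x) (0 : ℝ)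
  map_add' f g := derAux_eq _ _ fun ℓ x => by
    have h := (hasDerivAt_derAux f ℓ x).add (hasDerivAt_derAux g ℓ x)
    rw [← map_add] at h
    refine hasDerivAt_congr ℓ h fun y => ?_
    simp

theorem hasDerivAt (f : superFun A U) (ℓ : A →ₗ[ℝ] ℝ) (x : U) :
    HasDerivAt (fun t => ℓ (ambient f.1 t)) (ℓ ((der U f).1 x)) (toReal U x) :=
  hasDerivAt_derAux f ℓ x

theorem der_eq (f g : superFun A U) (h : ∀ (ℓ : A →ₗ[ℝ] ℝ) (x : U),
    HasDerivAt (fun t => ℓ (ambient f.1 t)) (ℓ (g.1 x)) (toReal U x)) : der U f = g :=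
  derAux_eq f g h

theorem linear_mul_eq_sum (ℓ : A →ₗ[ℝ] ℝ) (a b : A) :
    ℓ (a * b) = ∑ i, ∑ j, (Module.finBasis ℝ A).coord i a * (Module.finBasis ℝ A).coord j b *
      ℓ (Module.finBasis ℝ A i * Module.finBasis ℝ A j) := by
  conv_lhs => rw [← (Module.finBasis ℝ A).sum_repr a, ← (Module.finBasis ℝ A).sum_repr b,
    Finset.sum_mul_sum, map_sum]
  refine Finset.sum_congr rfl fun i _ => ?_
  rw [map_sum]
  refine Finset.sum_congr rfl fun j _ => ?_
  simp only [smul_mul_smul_comm, map_smul, smul_eq_mul, Module.Basis.coord_apply]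

theorem der_mul (f g : superFun A U) : der U (f * g) = der U f * g + f * der U g :=
  der_eq _ _ fun ℓ x => by
    -- In a basis of `A`, `ℓ(fg)` is a finite combination of products of real functions, so the real
    -- product rule applies.
    have h := HasDerivAt.fun_sum fun i (_ : i ∈ Finset.univ) =>
      HasDerivAt.fun_sum fun j (_ : j ∈ Finset.univ) =>
      ((hasDerivAt f ((Module.finBasis ℝ A).coord i) x).mul
        (hasDerivAt g ((Module.finBasis ℝ A).coord j) x)).mul_const
        (ℓ (Module.finBasis ℝ A i * Module.finBasis ℝ A j))
    refine hasDerivAt_congr ℓ (h.congr_deriv ?_) fun y => ?_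
    · change _ = ℓ ((der U f).1 x * g.1 x + f.1 x * (der U g).1 x)
      rw [map_add, linear_mul_eq_sum, linear_mul_eq_sum, ← Finset.sum_add_distrib]
      refine Finset.sum_congr rfl fun i _ => ?_
      rw [← Finset.sum_add_distrib]
      refine Finset.sum_congr rfl fun j _ => ?_
      simp only [ambient_apply]
      ring
    · change _ = ℓ (f.1 y * g.1 y)
      rw [linear_mul_eq_sum]
      simp [Pi.mul_apply]

@[simp]
theorem der_const (a : A) : der U (const U a) = 0 :=
  der_eq _ _ fun ℓ x => hasDerivAt_congr ℓ (F := fun _ => ℓ a) (v := ℓ 0)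
    (by simpa using hasDerivAt_const (toReal U x) (ℓ a)) fun _ => rfl

theorem der_res (h : U ≤ V) (f : superFun A V) : der U (res h f) = res h (der V f) :=
  der_eq _ _ fun ℓ x => by
    have h' := hasDerivAt f ℓ ⟨x.1, h x.2⟩
    exact hasDerivAt_congr (x := x) ℓ h' fun y => congrArg ℓ (ambient_apply f.1 ⟨y.1, h y.2⟩)

/-- A value outside `S` would be detected by a functional that vanishes on `S`, but the composite of
`f` with this functional is zero. With `S = 𝒜 k`, differentiation preserves parity. -/
theorem der_mem_submodule (S : Submodule ℝ A) {f : superFun A U} (hf : ∀ x, f.1 x ∈ S) (x : U) :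
    (der U f).1 x ∈ S := by
  by_contra hx
  obtain ⟨ℓ, hℓ, hS⟩ := Submodule.exists_le_ker_of_notMem hx
  refine hℓ ((hasDerivAt f ℓ x).unique ?_)
  exact hasDerivAt_congr ℓ (F := fun _ => 0) (hasDerivAt_const _ _) fun y => (hS (hf y)).symm

theorem der_mem (𝒜 : ZMod 2 → Submodule ℝ A) {f : superFun A U} {k : ZMod 2}
    (hf : f ∈ par 𝒜 U k) : der U f ∈ par 𝒜 U k :=
  der_mem_submodule (𝒜 k) hf

theorem eq_of_der_eq_zero (hU : IsPreconnected (Set.univ : Set U)) {f : superFun A U}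
    (hf : der U f = 0) (x y : U) : f.1 x = f.1 y := by
  refine eq_of_forall_linear fun ℓ => ?_
  have hopen : IsOpen (Set.range (toReal U)) := (isOpenEmbedding_toReal U).isOpen_range
  have hc : IsPreconnected (Set.range (toReal U)) := by
    rw [← Set.image_univ]
    exact hU.image _ (isOpenEmbedding_toReal U).continuous.continuousOn
  have hd : ∀ t ∈ Set.range (toReal U), HasDerivAt (fun t => ℓ (ambient f.1 t)) 0 t := by
    rintro _ ⟨z, rfl⟩
    have := hasDerivAt f ℓ z
    rw [hf] at this
    simpa using this
  have := hopen.is_const_of_deriv_eq_zero hc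
    (fun t ht => (hd t ht).differentiableAt.differentiableWithinAt)
    (fun t ht => (hd t ht).deriv) (Set.mem_range_self x) (Set.mem_range_self y)
  simpa using this

variable (A) in
/-- The coordinate function of `I`, as a superfunction. -/
def coord (U : Opens I) : superFun A U :=
  ofReal (fun t => algebraMap ℝ A t) fun ℓ x => by
    have : (fun t : ℝ => ℓ (algebraMap ℝ A t)) = fun t => t * ℓ 1 := by
      funext t
      rw [Algebra.algebraMap_eq_smul_one, map_smul, smul_eq_mul]
    rw [this]
    exact contDiffAt_id.mul contDiffAt_const

end superFun

/-! ### Linear ordinary differential equations -/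

section LinearODE

open MeasureTheory

/-- The terms of the Dyson series of the linear differential equation `y' = L y`, `y t₀ = v`. -/
noncomputable def dysonTerm {V : Type*} [NormedAddCommGroup V] [NormedSpace ℝ V]
    (L : ℝ → V →L[ℝ] V) (t₀ : ℝ) (v : V) : ℕ → ℝ → V
  | 0 => fun _ => v
  | n + 1 => fun t => ∫ τ in t₀..t, L τ (dysonTerm L t₀ v n τ)

variable {V : Type*} [NormedAddCommGroup V] [NormedSpace ℝ V]
variable {L : ℝ → V →L[ℝ] V} {s : Set ℝ} {t₀ : ℝ} {v : V}

/-- Bootstrapping: if `y` is `C^n`, then so is `y' = L y`, hence `y` is `C^(n+1)`. -/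
theorem contDiffOn_of_hasDerivAt_linear (hs : IsOpen s) (hL : ContDiffOn ℝ ∞ L s) {y : ℝ → V}
    (hy : ∀ t ∈ s, HasDerivAt y (L t (y t)) t) : ContDiffOn ℝ ∞ y s := by
  rw [contDiffOn_infty]
  intro n
  induction n with
  | zero => exact contDiffOn_zero.2 fun t ht => (hy t ht).continuousAt.continuousWithinAt
  | succ n ih =>
    rw [Nat.cast_succ, contDiffOn_succ_iff_deriv_of_isOpen hs]
    refine ⟨fun t ht => (hy t ht).differentiableAt.differentiableWithinAt, by simp, ?_⟩
    refine ((hL.of_le (by exact_mod_cast le_top)).clm_apply ih).congr fun t ht => (hy t ht).deriv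

variable [CompleteSpace V]

theorem hasDerivAt_dysonTerm (hs : IsOpen s) (hc : s.OrdConnected) (hL : ContinuousOn L s)
    (ht₀ : t₀ ∈ s) (n : ℕ) (hn : ContinuousOn (dysonTerm L t₀ v n) s) {t : ℝ} (ht : t ∈ s) :
    HasDerivAt (dysonTerm L t₀ v (n + 1)) (L t (dysonTerm L t₀ v n t)) t := by
  have h : ContinuousOn (fun τ => L τ (dysonTerm L t₀ v n τ)) s := hL.clm_apply hn
  exact intervalIntegral.integral_hasDerivAt_right
    (h.mono (hc.uIcc_subset ht₀ ht)).intervalIntegrable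
    (h.stronglyMeasurableAtFilter hs t ht) (h.continuousAt (hs.mem_nhds ht))

theorem continuousOn_dysonTerm (hs : IsOpen s) (hc : s.OrdConnected) (hL : ContinuousOn L s)
    (ht₀ : t₀ ∈ s) (n : ℕ) : ContinuousOn (dysonTerm L t₀ v n) s := by
  induction n with
  | zero => exact continuousOn_const
  | succ n ih => exact fun t ht =>
      (hasDerivAt_dysonTerm hs hc hL ht₀ n ih ht).continuousAt.continuousWithinAt

/-- Each step multiplies by at most `C` and integrates `|τ - t₀|^n` to `|t - t₀|^(n+1) / (n+1)`,
which builds up the factorial. The interval `r` is where `L` is bounded; on all of `s` it need not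
be. -/
theorem norm_dysonTerm_le (hs : IsOpen s) (hc : s.OrdConnected) (hL : ContinuousOn L s)
    (ht₀ : t₀ ∈ s) {C : ℝ} {r : Set ℝ} (hr : r.OrdConnected) (hrs : r ⊆ s) (htr : t₀ ∈ r)
    (hC : ∀ t ∈ r, ‖L t‖ ≤ C) (n : ℕ) {t : ℝ} (ht : t ∈ r) :
    ‖dysonTerm L t₀ v n t‖ ≤ ‖v‖ * (C * |t - t₀|) ^ n / n.factorial := by
  have hC0 : 0 ≤ C := (norm_nonneg _).trans (hC t₀ htr)
  induction n generalizing t with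
  | zero => simp [dysonTerm]
  | succ n ih =>
    have hsub : Set.uIoc t₀ t ⊆ r := Set.uIoc_subset_uIcc.trans (hr.uIcc_subset htr ht)
    have h1 : ‖dysonTerm L t₀ v (n + 1) t‖ ≤
        ∫ τ in Set.uIoc t₀ t, ‖L τ (dysonTerm L t₀ v n τ)‖ :=
      intervalIntegral.norm_integral_le_integral_norm_uIoc
    have hcont : ContinuousOn (fun τ => L τ (dysonTerm L t₀ v n τ)) (Set.uIcc t₀ t) :=
      (hL.clm_apply (continuousOn_dysonTerm hs hc hL ht₀ n)).mono
        ((hr.uIcc_subset htr ht).trans hrs)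
    have h2 : ∫ τ in Set.uIoc t₀ t, ‖L τ (dysonTerm L t₀ v n τ)‖ ≤
        ∫ τ in Set.uIoc t₀ t, (‖v‖ * C ^ (n + 1) / n.factorial) * |τ - t₀| ^ n := by
      refine setIntegral_mono_on ?_ ?_ measurableSet_uIoc fun τ hτ => ?_
      · exact (hcont.norm.integrableOn_compact isCompact_uIcc).mono_set Set.uIoc_subset_uIcc
      · have : Continuous fun τ : ℝ => (‖v‖ * C ^ (n + 1) / n.factorial) * |τ - t₀| ^ n := by
          fun_prop
        exact (this.continuousOn.integrableOn_compact isCompact_uIcc).mono_set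
          Set.uIoc_subset_uIcc
      · refine ((L τ).le_opNorm _).trans ?_
        refine (mul_le_mul (hC τ (hsub hτ)) (ih (hsub hτ)) (norm_nonneg _) hC0).trans_eq ?_
        rw [mul_pow]
        ring
    refine h1.trans (h2.trans_eq ?_)
    rw [integral_const_mul, integral_pow_abs_sub_uIoc, Nat.factorial_succ, mul_pow]
    have : (n.factorial : ℝ) ≠ 0 := by positivity
    have : (n : ℝ) + 1 ≠ 0 := by positivity
    push_cast
    field_simp

/-- The Dyson series is dominated by an exponential series on each compact subinterval, so it may be
differentiated term by term. The solution is given by one formula on all of `s`, so no continuation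
argument is needed. -/
theorem exists_hasDerivAt_linear (hs : IsOpen s) (hc : s.OrdConnected) (hL : ContinuousOn L s)
    (ht₀ : t₀ ∈ s) (v : V) :
    ∃ y : ℝ → V, y t₀ = v ∧ ∀ t ∈ s, HasDerivAt y (L t (y t)) t := by
  have hd := fun n t (ht : t ∈ s) => hasDerivAt_dysonTerm (v := v) hs hc hL ht₀ n
    (continuousOn_dysonTerm hs hc hL ht₀ n) ht
  have h0 : ∀ n, dysonTerm L t₀ v (n + 1) t₀ = 0 := fun n => intervalIntegral.integral_same
  -- The constant term `v` is split off, so that every term left in the series vanishes at `t₀` and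
  -- is the integral of its predecessor.
  refine ⟨fun t => v + ∑' n, dysonTerm L t₀ v (n + 1) t, by simp [h0], fun t ht => ?_⟩
  -- A compact interval in `s` having both `t` and `t₀` in its interior.
  have key : ∃ c d, Set.Icc c d ⊆ s ∧ t ∈ Set.Ioo c d ∧ t₀ ∈ Set.Ioo c d := by
    have hmin : min t t₀ ∈ s := by rcases min_choice t t₀ with h | h <;> rwa [h]
    have hmax : max t t₀ ∈ s := by rcases max_choice t t₀ with h | h <;> rwa [h]
    obtain ⟨ε, hε, h₁⟩ := Metric.isOpen_iff.1 hs _ hmin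
    obtain ⟨δ, hδ, h₂⟩ := Metric.isOpen_iff.1 hs _ hmax
    refine ⟨min t t₀ - ε / 2, max t t₀ + δ / 2, hc.out (h₁ ?_) (h₂ ?_), ⟨?_, ?_⟩, ⟨?_, ?_⟩⟩
    · rw [Metric.mem_ball, Real.dist_eq, abs_lt]; constructor <;> linarith
    · rw [Metric.mem_ball, Real.dist_eq, abs_lt]; constructor <;> linarith
    · linarith [min_le_left t t₀]
    · linarith [le_max_left t t₀]
    · linarith [min_le_right t t₀]
    · linarith [le_max_right t t₀]
  obtain ⟨c, d, hcd, htcd, ht₀cd⟩ := key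
  obtain ⟨C, hC⟩ := isCompact_Icc.exists_bound_of_continuousOn (hL.mono hcd)
  have hC0 : 0 ≤ C := (norm_nonneg _).trans (hC t (Set.Ioo_subset_Icc_self htcd))
  have hb : ∀ n, ∀ τ ∈ Set.Ioo c d,
      ‖dysonTerm L t₀ v n τ‖ ≤ ‖v‖ * ((C * (d - c)) ^ n / n.factorial) := by
    intro n τ hτ
    refine (norm_dysonTerm_le hs hc hL ht₀ Set.ordConnected_Icc hcd
      (Set.Ioo_subset_Icc_self ht₀cd) hC n (Set.Ioo_subset_Icc_self hτ)).trans ?_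
    rw [mul_div_assoc]
    gcongr
    rw [abs_le]
    constructor <;> linarith [hτ.1, hτ.2, ht₀cd.1, ht₀cd.2]
  have hsum : Summable fun n : ℕ => ‖v‖ * ((C * (d - c)) ^ n / n.factorial) :=
    (Real.summable_pow_div_factorial _).mul_left _
  have hY : ∀ τ ∈ Set.Ioo c d, Summable fun n => dysonTerm L t₀ v n τ := fun τ hτ =>
    .of_norm_bounded hsum fun n => hb n τ hτ
  have hD := hasDerivAt_tsum_of_isPreconnected (hsum.mul_left C) isOpen_Ioo isPreconnected_Ioo
    (fun n τ hτ => hd n τ (hcd (Set.Ioo_subset_Icc_self hτ)))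
    (fun n τ hτ => ((L τ).le_opNorm _).trans
      (mul_le_mul (hC τ (Set.Ioo_subset_Icc_self hτ)) (hb n τ hτ) (norm_nonneg _) hC0))
    ht₀cd (by simp [h0]) htcd
  refine (hD.const_add v).congr_deriv ?_
  -- The differentiated series is `L t` applied to the full Dyson series, whose term of index `0` is
  -- the `v` split off above.
  rw [← (L t).map_tsum (hY t htcd), (hY t htcd).tsum_eq_zero_add]
  rfl

end LinearODE

/-- Linear differential equations in a finite-dimensional space, with smooth coefficients on an open
interval, have smooth solutions on the whole interval. -/
theorem exists_smooth_solution_linear {M : Type*} [AddCommGroup M] [Module ℝ M]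
    [FiniteDimensional ℝ M] {κ : Type*} [Fintype κ] {s : Set ℝ} (hs : IsOpen s)
    (hc : s.OrdConnected) {t₀ : ℝ} (ht₀ : t₀ ∈ s) (γ : κ → ℝ → ℝ)
    (hγ : ∀ j, ContDiffOn ℝ ∞ (γ j) s) (R : κ → M →ₗ[ℝ] M) (v : M) :
    ∃ y : ℝ → M, y t₀ = v ∧ ∀ ℓ : M →ₗ[ℝ] ℝ, ContDiffOn ℝ ∞ (fun t => ℓ (y t)) s ∧
      ∀ t ∈ s, HasDerivAt (fun t => ℓ (y t)) (ℓ (∑ j, γ j t • R j (y t))) t := by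
  -- `M` carries no norm; the equation is solved in coordinates and read back through functionals.
  let e : M ≃ₗ[ℝ] (Fin (Module.finrank ℝ M) → ℝ) := (Module.finBasis ℝ M).equivFun
  let L : ℝ → (Fin (Module.finrank ℝ M) → ℝ) →L[ℝ] (Fin (Module.finrank ℝ M) → ℝ) := fun t =>
    ∑ j, γ j t • (e.toLinearMap ∘ₗ R j ∘ₗ e.symm.toLinearMap).toContinuousLinearMap
  have hL : ContDiffOn ℝ ∞ L s := ContDiffOn.sum fun j _ => (hγ j).smul contDiffOn_const
  obtain ⟨z, hz₀, hz⟩ := exists_hasDerivAt_linear hs hc hL.continuousOn ht₀ (e v)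
  have hzs := contDiffOn_of_hasDerivAt_linear hs hL hz
  refine ⟨fun t => e.symm (z t), by simp [hz₀], fun ℓ => ⟨?_, fun t ht => ?_⟩⟩
  · exact (ℓ ∘ₗ e.symm.toLinearMap).toContinuousLinearMap.contDiff.comp_contDiffOn hzs
  · have := (ℓ ∘ₗ e.symm.toLinearMap).toContinuousLinearMap.hasFDerivAt.comp_hasDerivAt t (hz t ht)
    refine this.congr_deriv ?_
    simp [L]

/-! ### Matrices of superfunctions -/

namespace superFun

/-- A finite-dimensional algebra is Artinian, and there one-sided inverses are two-sided. It
replaces determinants for matrices over the noncommutative `A`. -/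
theorem mul_eq_one_symm_of_finiteDimensional {B : Type*} [Ring B] [Algebra ℝ B]
    [FiniteDimensional ℝ B] {a b : B} (h : a * b = 1) : b * a = 1 := by
  have : IsArtinianRing B := isArtinian_of_tower ℝ inferInstance
  exact mul_eq_one_symm h

variable {X : Type} [TopologicalSpace X] [ChartedSpace ℝ X]
variable {A : Type*} [Ring A] [Algebra ℝ A] [FiniteDimensional ℝ A]
variable {ι : Type*} [Fintype ι] [DecidableEq ι]

/-- Evaluation of superfunctions at a point. -/
def evalAt {U : Opens X} (x : U) : superFun A U →+* A :=
  (Pi.evalRingHom (fun _ => A) x).comp (superFun A U).val.toRingHom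

/-- The values of a matrix of superfunctions at a point. -/
def matEval {U : Opens X} (x : U) : Matrix ι ι (superFun A U) →+* Matrix ι ι A :=
  (evalAt x).mapMatrix

theorem matrix_ext {U : Opens X} {M N : Matrix ι ι (superFun A U)}
    (h : ∀ x, matEval x M = matEval x N) : M = N := by
  ext k l x
  exact congrFun₂ (h x) k l

/-- Restriction of matrices of superfunctions. -/
def matRes {U V : Opens X} (h : U ≤ V) :
    Matrix ι ι (superFun A V) →+* Matrix ι ι (superFun A U) :=
  (res h).toRingHom.mapMatrix

@[simp]
theorem matRes_apply {U V : Opens X} (h : U ≤ V) (M : Matrix ι ι (superFun A V)) (k l : ι) :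
    matRes h M k l = res h (M k l) := rfl

/-- The constant matrices. -/
def matConst (U : Opens X) : Matrix ι ι A →+* Matrix ι ι (superFun A U) :=
  (const U).toRingHom.mapMatrix

/-- A matrix of superfunctions is even with respect to the parities `π` of the indices. -/
def IsEvenMatrix (𝒜 : ZMod 2 → Submodule ℝ A) (π : ι → ZMod 2) {U : Opens X}
    (M : Matrix ι ι (superFun A U)) : Prop :=
  ∀ k l, M k l ∈ par 𝒜 U (π k + π l)

/-! ### Even matrices and the even part of a matrix -/

section Even

variable {𝒜 : ZMod 2 → Submodule ℝ A} {π : ι → ZMod 2} {U V : Opens X}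


theorem parity_add_add (i j k : ZMod 2) : i + j + (j + k) = i + k := by
  rw [add_assoc, ← add_assoc j, CharTwo.add_self_eq_zero, zero_add]

theorem IsEvenMatrix.mul [GradedAlgebra 𝒜] {M N : Matrix ι ι (superFun A U)}
    (hM : IsEvenMatrix 𝒜 π M) (hN : IsEvenMatrix 𝒜 π N) : IsEvenMatrix 𝒜 π (M * N) := by
  intro k l
  rw [Matrix.mul_apply]
  refine sum_mem fun m _ => ?_
  rw [← parity_add_add _ (π m)]
  exact mul_mem 𝒜 (hM k m) (hN m l)

theorem IsEvenMatrix.one [GradedAlgebra 𝒜] :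
    IsEvenMatrix 𝒜 π (1 : Matrix ι ι (superFun A U)) := by
  intro k l
  rcases eq_or_ne k l with rfl | h
  · rw [Matrix.one_apply_eq, CharTwo.add_self_eq_zero]
    exact fun x => SetLike.GradedOne.one_mem
  · rw [Matrix.one_apply_ne h]
    exact AddSubgroup.zero_mem _

theorem IsEvenMatrix.neg {M : Matrix ι ι (superFun A U)} (hM : IsEvenMatrix 𝒜 π M) :
    IsEvenMatrix 𝒜 π (-M) := fun k l => neg_mem (hM k l)

theorem IsEvenMatrix.matRes {M : Matrix ι ι (superFun A V)} (hM : IsEvenMatrix 𝒜 π M)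
    (h : U ≤ V) : IsEvenMatrix 𝒜 π (matRes h M) := fun k l => res_mem 𝒜 h (hM k l)

theorem IsEvenMatrix.matConst_matEval {M : Matrix ι ι (superFun A V)}
    (hM : IsEvenMatrix 𝒜 π M) (x : V) : IsEvenMatrix 𝒜 π (matConst U (matEval x M)) :=
  fun k l _ => hM k l x

/-- The even component of a matrix of superfunctions. -/
def evenPart (𝒜 : ZMod 2 → Submodule ℝ A) [GradedAlgebra 𝒜] (π : ι → ZMod 2)
    (M : Matrix ι ι (superFun A U)) : Matrix ι ι (superFun A U) :=
  fun k l => comp 𝒜 (π k + π l) (M k l)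

theorem isEvenMatrix_evenPart [GradedAlgebra 𝒜] (M : Matrix ι ι (superFun A U)) :
    IsEvenMatrix 𝒜 π (evenPart 𝒜 π M) := fun k l => comp_mem 𝒜 _ (M k l)

theorem comp_add [GradedAlgebra 𝒜] (k : ZMod 2) (f g : superFun A U) :
    comp 𝒜 k (f + g) = comp 𝒜 k f + comp 𝒜 k g := by
  ext x
  exact map_add (GradedAlgebra.proj 𝒜 k) (f.1 x) (g.1 x)

theorem comp_zero [GradedAlgebra 𝒜] (k : ZMod 2) : comp 𝒜 k (0 : superFun A U) = 0 := by
  ext x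
  exact map_zero (GradedAlgebra.proj 𝒜 k)

theorem comp_neg [GradedAlgebra 𝒜] (k : ZMod 2) (f : superFun A U) :
    comp 𝒜 k (-f) = -comp 𝒜 k f := by
  ext x
  exact map_neg (GradedAlgebra.proj 𝒜 k) (f.1 x)

theorem comp_sum [GradedAlgebra 𝒜] (k : ZMod 2) {κ : Type*} (s : Finset κ)
    (f : κ → superFun A U) : comp 𝒜 k (∑ i ∈ s, f i) = ∑ i ∈ s, comp 𝒜 k (f i) :=
  map_sum (⟨⟨comp 𝒜 k, comp_zero k⟩, comp_add k⟩ : superFun A U →+ superFun A U) f s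

theorem comp_of_mem [GradedAlgebra 𝒜] {k : ZMod 2} {f : superFun A U} (hf : f ∈ par 𝒜 U k) :
    comp 𝒜 k f = f := by
  ext x
  exact DirectSum.decompose_of_mem_same 𝒜 (hf x)

theorem comp_add_mul_right [GradedAlgebra 𝒜] {i j : ZMod 2} (f : superFun A U)
    {g : superFun A U} (hg : g ∈ par 𝒜 U j) : comp 𝒜 (i + j) (f * g) = comp 𝒜 i f * g := by
  ext x
  exact DirectSum.coe_decompose_mul_add_of_right_mem 𝒜 (hg x)

theorem comp_add_mul_left [GradedAlgebra 𝒜] {i j : ZMod 2} {f : superFun A U}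
    (hf : f ∈ par 𝒜 U i) (g : superFun A U) : comp 𝒜 (i + j) (f * g) = f * comp 𝒜 j g := by
  ext x
  exact DirectSum.coe_decompose_mul_add_of_left_mem 𝒜 (hf x)

theorem evenPart_neg [GradedAlgebra 𝒜] (M : Matrix ι ι (superFun A U)) :
    evenPart 𝒜 π (-M) = -evenPart 𝒜 π M := by
  ext1 k l
  exact comp_neg _ _

theorem evenPart_of_even [GradedAlgebra 𝒜] {M : Matrix ι ι (superFun A U)}
    (hM : IsEvenMatrix 𝒜 π M) : evenPart 𝒜 π M = M := by
  ext1 k l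
  exact comp_of_mem (hM k l)

/-- Multiplication by an even matrix preserves degrees, hence commutes with the projection to the
even part. This is why the even part of a solution of `G' = -GΓ` with `Γ` even is again a solution.
-/
theorem evenPart_mul_right [GradedAlgebra 𝒜] (M : Matrix ι ι (superFun A U))
    {N : Matrix ι ι (superFun A U)} (hN : IsEvenMatrix 𝒜 π N) :
    evenPart 𝒜 π (M * N) = evenPart 𝒜 π M * N := by
  ext1 k l
  simp only [evenPart, Matrix.mul_apply]
  rw [comp_sum]
  refine Finset.sum_congr rfl fun m _ => ?_
  rw [← parity_add_add _ (π m), comp_add_mul_right _ (hN m l)]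

theorem evenPart_mul_left [GradedAlgebra 𝒜] {M : Matrix ι ι (superFun A U)}
    (hM : IsEvenMatrix 𝒜 π M) (N : Matrix ι ι (superFun A U)) :
    evenPart 𝒜 π (M * N) = M * evenPart 𝒜 π N := by
  ext1 k l
  simp only [evenPart, Matrix.mul_apply]
  rw [comp_sum]
  refine Finset.sum_congr rfl fun m _ => ?_
  rw [← parity_add_add _ (π m), comp_add_mul_left (hM k m)]

theorem matEval_evenPart_of_eq [GradedAlgebra 𝒜] {M N : Matrix ι ι (superFun A U)} {x : U}
    (h : matEval x M = matEval x N) :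
    matEval x (evenPart 𝒜 π M) = matEval x (evenPart 𝒜 π N) := by
  ext k l
  exact congrArg (fun a => GradedAlgebra.proj 𝒜 (π k + π l) a) (congrFun₂ h k l)

end Even

/-! ### Fundamental solutions -/

section Interval

variable {I : Opens ℝ} {U V : Opens I}
variable {𝒜 : ZMod 2 → Submodule ℝ A} {π : ι → ZMod 2}

/-- The entrywise derivative of a matrix of superfunctions. -/
noncomputable def matDer (M : Matrix ι ι (superFun A U)) : Matrix ι ι (superFun A U) :=
  M.map (der U)

theorem matDer_mul (M N : Matrix ι ι (superFun A U)) :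
    matDer (M * N) = matDer M * N + M * matDer N := by
  ext1 k l
  simp only [matDer, Matrix.map_apply, Matrix.mul_apply, Matrix.add_apply, map_sum, der_mul,
    Finset.sum_add_distrib]

theorem matDer_matRes (h : U ≤ V) (M : Matrix ι ι (superFun A V)) :
    matDer (matRes h M) = matRes h (matDer M) := by
  ext1 k l
  exact der_res h (M k l)

theorem IsEvenMatrix.matDer {M : Matrix ι ι (superFun A U)} (hM : IsEvenMatrix 𝒜 π M) :
    IsEvenMatrix 𝒜 π (matDer M) := fun k l => der_mem 𝒜 (hM k l)

theorem eq_matConst_of_matDer_eq_zero (hU : IsPreconnected (Set.univ : Set U))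
    {M : Matrix ι ι (superFun A U)} (hM : matDer M = 0) (x : U) :
    M = matConst U (matEval x M) := by
  ext k l y
  exact eq_of_der_eq_zero hU (congrFun₂ hM k l) y x

theorem der_comp [GradedAlgebra 𝒜] (k : ZMod 2) (f : superFun A U) :
    der U (comp 𝒜 k f) = comp 𝒜 k (der U f) :=
  der_eq _ _ fun ℓ x => hasDerivAt_congr ℓ (hasDerivAt f (ℓ ∘ₗ GradedAlgebra.proj 𝒜 k) x)
    fun y => by rw [ambient_apply]; rfl

theorem matDer_evenPart [GradedAlgebra 𝒜] (M : Matrix ι ι (superFun A U)) :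
    matDer (evenPart 𝒜 π M) = evenPart 𝒜 π (matDer M) := by
  ext1 k l
  exact der_comp _ _

theorem range_toReal_top : Set.range (toReal (⊤ : Opens I)) = I := by
  ext t
  constructor
  · rintro ⟨x, rfl⟩
    exact x.1.2
  · intro ht
    exact ⟨⟨⟨t, ht⟩, trivial⟩, rfl⟩

theorem isPreconnected_univ_top (hI : (I : Set ℝ).OrdConnected) :
    IsPreconnected (Set.univ : Set (⊤ : Opens I)) := by
  rw [← (isOpenEmbedding_toReal _).isInducing.isPreconnected_image, Set.image_univ,
    range_toReal_top]
  exact hI.isPreconnected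

theorem sum_single_coord (M : Matrix ι ι A) :
    ∑ j : (ι × ι) × Fin (Module.finrank ℝ A), (Module.finBasis ℝ A).coord j.2 (M j.1.1 j.1.2) •
      Matrix.single j.1.1 j.1.2 (Module.finBasis ℝ A j.2) = M := by
  rw [Fintype.sum_prod_type, Fintype.sum_prod_type]
  conv_rhs => rw [Matrix.matrix_eq_sum_single M]
  refine Finset.sum_congr rfl fun k _ => Finset.sum_congr rfl fun l _ => ?_
  conv_rhs => rw [← (Module.finBasis ℝ A).sum_repr (M k l)]
  simp only [Module.Basis.coord_apply, Matrix.smul_single]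
  exact (map_sum (Matrix.singleLinearMap ℝ k l) _ _).symm

/-- Linear matrix differential equations `Y' = B(Γ, Y)` on an interval have solutions. -/
theorem exists_matDer_eq (hI : (I : Set ℝ).OrdConnected) (x₀ : (⊤ : Opens I))
    (Γ : Matrix ι ι (superFun A (⊤ : Opens I)))
    (B : Matrix ι ι A →ₗ[ℝ] Matrix ι ι A →ₗ[ℝ] Matrix ι ι A) :
    ∃ Y : Matrix ι ι (superFun A (⊤ : Opens I)), matEval x₀ Y = 1 ∧
      ∀ x, matEval x (matDer Y) = B (matEval x Γ) (matEval x Y) := by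
  -- Expanding `Γ` in matrix units times a basis of `A` writes `B(Γ, ·)` as a sum of real functions
  -- times constant endomorphisms.
  obtain ⟨y, hy₀, hy⟩ := exists_smooth_solution_linear (M := Matrix ι ι A) I.isOpen hI x₀.1.2
    (fun (j : (ι × ι) × Fin (Module.finrank ℝ A)) t =>
      (Module.finBasis ℝ A).coord j.2 (ambient (Γ j.1.1 j.1.2).1 t))
    (fun j t ht => (contDiffAt_ambient (Γ j.1.1 j.1.2) _
      (⟨⟨t, ht⟩, trivial⟩ : (⊤ : Opens I))).contDiffWithinAt)
    (fun j => B (Matrix.single j.1.1 j.1.2 (Module.finBasis ℝ A j.2))) 1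
  let Y : Matrix ι ι (superFun A (⊤ : Opens I)) := fun k l =>
    ofReal (fun t => y t k l) fun ℓ x =>
      ((hy (ℓ ∘ₗ Matrix.entryLinearMap ℝ A k l)).1.contDiffAt (I.isOpen.mem_nhds x.1.2))
  refine ⟨Y, hy₀, fun x => ?_⟩
  have hx := fun ℓ => (hy ℓ).2 (toReal _ x) x.1.2
  have hder : ∑ j : (ι × ι) × Fin (Module.finrank ℝ A),
      (Module.finBasis ℝ A).coord j.2 (ambient (Γ j.1.1 j.1.2).1 (toReal _ x)) •
        B (Matrix.single j.1.1 j.1.2 (Module.finBasis ℝ A j.2)) (y (toReal _ x)) =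
      B (matEval x Γ) (matEval x Y) := by
    conv_rhs => rw [← sum_single_coord (matEval x Γ), map_sum, LinearMap.sum_apply]
    refine Finset.sum_congr rfl fun j _ => ?_
    rw [ambient_apply, map_smul, LinearMap.smul_apply]
    rfl
  rw [hder] at hx
  ext k l
  refine eq_of_forall_linear fun ℓ => (hasDerivAt (Y k l) ℓ x).unique ?_
  exact hasDerivAt_congr ℓ (hx (ℓ ∘ₗ Matrix.entryLinearMap ℝ A k l)) fun _ => rfl

/-- The fundamental solution `G` of `G' = -GΓ` and its inverse `H`. -/
theorem exists_fundamental [GradedAlgebra 𝒜] (hI : (I : Set ℝ).OrdConnected)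
    {Γ : Matrix ι ι (superFun A (⊤ : Opens I))} (hΓ : IsEvenMatrix 𝒜 π Γ) :
    ∃ G H : Matrix ι ι (superFun A (⊤ : Opens I)), IsEvenMatrix 𝒜 π G ∧ IsEvenMatrix 𝒜 π H ∧
      G * H = 1 ∧ H * G = 1 ∧ matDer G = -(G * Γ) ∧ matDer H = Γ * H := by
  rcases isEmpty_or_nonempty (⊤ : Opens I) with he | ⟨⟨x₀⟩⟩
  · exact ⟨1, 1, .one, .one, one_mul 1, one_mul 1, matrix_ext fun x => he.elim x,
      matrix_ext fun x => he.elim x⟩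
  obtain ⟨G, hG₀, hG⟩ := exists_matDer_eq hI x₀ Γ (-(LinearMap.mul ℝ (Matrix ι ι A)).flip)
  obtain ⟨H, hH₀, hH⟩ := exists_matDer_eq hI x₀ Γ (LinearMap.mul ℝ (Matrix ι ι A))
  have hG' : matDer G = -(G * Γ) := matrix_ext fun x => by simp [hG]
  have hH' : matDer H = Γ * H := matrix_ext fun x => by simp [hH]
  have hone : matEval x₀ (1 : Matrix ι ι (superFun A (⊤ : Opens I))) = 1 := map_one _
  -- The even parts satisfy the same equations and the same initial condition, the identity matrix
  -- being even.
  have eG : matDer (evenPart 𝒜 π G) = -(evenPart 𝒜 π G * Γ) := by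
    rw [matDer_evenPart, hG', evenPart_neg, evenPart_mul_right _ hΓ]
  have eH : matDer (evenPart 𝒜 π H) = Γ * evenPart 𝒜 π H := by
    rw [matDer_evenPart, hH', evenPart_mul_left hΓ]
  have eG₀ : matEval x₀ (evenPart 𝒜 π G) = 1 := by
    rw [matEval_evenPart_of_eq (hG₀.trans hone.symm), evenPart_of_even .one, hone]
  have eH₀ : matEval x₀ (evenPart 𝒜 π H) = 1 := by
    rw [matEval_evenPart_of_eq (hH₀.trans hone.symm), evenPart_of_even .one, hone]
  -- The two equations are chosen so that `(GH)' = -GΓH + GΓH = 0`. For `HG` no such cancellation is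
  -- available, so it is treated pointwise in the finite-dimensional matrix algebra.
  have hGH : evenPart 𝒜 π G * evenPart 𝒜 π H = 1 := by
    have h0 : matDer (evenPart 𝒜 π G * evenPart 𝒜 π H) = 0 := by
      rw [matDer_mul, eG, eH, Matrix.neg_mul, mul_assoc, neg_add_cancel]
    rw [eq_matConst_of_matDer_eq_zero (isPreconnected_univ_top hI) h0 x₀, map_mul, eG₀, eH₀,
      one_mul, map_one]
  refine ⟨evenPart 𝒜 π G, evenPart 𝒜 π H, isEvenMatrix_evenPart G, isEvenMatrix_evenPart H, hGH,
    matrix_ext fun x => ?_, eG, eH⟩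
  rw [map_mul, map_one]
  exact mul_eq_one_symm_of_finiteDimensional (by rw [← map_mul, hGH, map_one])

end Interval

end superFun

/-! ### Hadamard's lemma -/

section Hadamard

/-- Differentiating the integrand in `t` produces a factor `s`; with the weight `s ^ k` the family
of these integrals is closed under differentiation, so smoothness follows by induction. -/
theorem hasDerivAt_integral_pow_mul_comp (x : ℝ) (k : ℕ) {φ : ℝ → ℝ} (hφ : ContDiff ℝ 1 φ)
    (t : ℝ) : HasDerivAt (fun t => ∫ s in (0 : ℝ)..1, s ^ k * φ (x + s * (t - x)))
      (∫ s in (0 : ℝ)..1, s ^ (k + 1) * deriv φ (x + s * (t - x))) t := by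
  have hφ' : Continuous (deriv φ) := hφ.continuous_deriv le_rfl
  have hF : Continuous fun z : ℝ × ℝ => z.2 ^ (k + 1) * deriv φ (x + z.2 * (z.1 - x)) := by
    fun_prop
  obtain ⟨C, hC⟩ := ((isCompact_closedBall t 1).prod
    (isCompact_Icc (a := (0 : ℝ)) (b := 1))).exists_bound_of_continuousOn hF.continuousOn
  have hφc := hφ.continuous
  refine (intervalIntegral.hasDerivAt_integral_of_dominated_loc_of_deriv_le
    (F' := fun t s => s ^ (k + 1) * deriv φ (x + s * (t - x)))
    (bound := fun _ => C) (Metric.closedBall_mem_nhds t one_pos)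
    (.of_forall fun t' => ?_) ?_ ?_ (.of_forall fun s hs t' ht' => ?_) (by simp)
    (.of_forall fun s _ t' _ => ?_)).2
  · exact Continuous.aestronglyMeasurable (by fun_prop)
  · exact Continuous.intervalIntegrable (by fun_prop) _ _
  · exact Continuous.aestronglyMeasurable (by fun_prop)
  · rw [Set.uIoc_of_le zero_le_one] at hs
    exact hC (t', s) ⟨ht', hs.1.le, hs.2⟩
  · have h1 : HasDerivAt (fun t : ℝ => x + s * (t - x)) s t' := by
      simpa using (((hasDerivAt_id t').sub_const x).const_mul s).const_add x
    have h2 := ((hφ.differentiable (by simp) (x + s * (t' - x))).hasDerivAt.comp t' h1).const_mul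
      (s ^ k)
    refine h2.congr_deriv ?_
    ring

theorem contDiff_integral_pow_mul_comp (x : ℝ) (n : ℕ) :
    ∀ (k : ℕ) {φ : ℝ → ℝ}, ContDiff ℝ ∞ φ →
      ContDiff ℝ n fun t => ∫ s in (0 : ℝ)..1, s ^ k * φ (x + s * (t - x)) := by
  induction n with
  | zero => exact fun k φ hφ => contDiff_zero.2 <| continuous_iff_continuousAt.2 fun t =>
      (hasDerivAt_integral_pow_mul_comp x k (hφ.of_le (by simp)) t).continuousAt
  | succ n ih =>
    intro k φ hφ
    have hd := hasDerivAt_integral_pow_mul_comp x k (hφ.of_le (by simp))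
    rw [Nat.cast_succ, contDiff_succ_iff_deriv]
    refine ⟨fun t => (hd t).differentiableAt, by simp, ?_⟩
    rw [funext fun t => (hd t).deriv]
    exact ih (k + 1) (contDiff_infty_iff_deriv.1 hφ).2

/-- Hadamard's lemma for smooth functions on the real line. -/
theorem exists_eq_add_sub_mul {g : ℝ → ℝ} (hg : ContDiff ℝ ∞ g) (x : ℝ) :
    ∃ h : ℝ → ℝ, ContDiff ℝ ∞ h ∧ ∀ t, g t = g x + (t - x) * h t := by
  -- The integral form of `(g t - g x) / (t - x)`; the factor `s ^ 0` makes it the member `k = 0` of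
  -- the family above.
  refine ⟨fun t => ∫ s in (0 : ℝ)..1, s ^ 0 * deriv g (x + s * (t - x)),
    contDiff_infty.2 fun n => contDiff_integral_pow_mul_comp x n 0
      (contDiff_infty_iff_deriv.1 hg).2, fun t => ?_⟩
  have h := intervalIntegral.integral_eq_sub_of_hasDerivAt (a := 0) (b := 1)
    (f := fun s => g (x + s * (t - x))) (f' := fun s => (t - x) * deriv g (x + s * (t - x)))
    (fun s _ => by
      have h1 : HasDerivAt (fun s : ℝ => x + s * (t - x)) (t - x) s := by
        simpa using ((hasDerivAt_id s).mul_const (t - x)).const_add x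
      refine ((hg.differentiable (by simp) (x + s * (t - x))).hasDerivAt.comp s h1).congr_deriv ?_
      ring)
    (by
      have := hg.continuous_deriv (by simp)
      exact Continuous.intervalIntegrable (by fun_prop) _ _)
  rw [intervalIntegral.integral_const_mul] at h
  simp only [pow_zero, one_mul]
  rw [h]
  simp

end Hadamard

namespace superFun

variable {I : Opens ℝ} {A : Type*} [Ring A] [Algebra ℝ A] [FiniteDimensional ℝ A]
variable {U V : Opens I}

theorem coord_mem (𝒜 : ZMod 2 → Submodule ℝ A) [GradedAlgebra 𝒜] (U : Opens I) :
    coord A U ∈ par 𝒜 U 0 := by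
  intro x
  change algebraMap ℝ A _ ∈ _
  rw [Algebra.algebraMap_eq_smul_one]
  exact Submodule.smul_mem _ _ SetLike.GradedOne.one_mem

theorem der_coord (U : Opens I) : der U (coord A U) = 1 :=
  der_eq _ _ fun ℓ x => by
    have h := (hasDerivAt_id (toReal U x)).mul_const (ℓ 1)
    rw [one_mul] at h
    refine hasDerivAt_congr ℓ h fun y => ?_
    change toReal U y * ℓ 1 = ℓ (algebraMap ℝ A (toReal U y))
    rw [Algebra.algebraMap_eq_smul_one, map_smul, smul_eq_mul]

/-- Hadamard's lemma for superfunctions. -/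
theorem exists_res_eq_const_add (f : superFun A V) (x : V) :
    ∃ (W : Opens I) (h : W ≤ V) (_ : x.1 ∈ W) (g : superFun A W),
      res h f = const W (f.1 x) + (coord A W - const W (algebraMap ℝ A (toReal V x))) * g := by
  obtain ⟨ε, hε, hball⟩ := Metric.isOpen_iff.1 (isOpenEmbedding_toReal V).isOpen_range _
    (Set.mem_range_self x)
  -- Supported inside `V` and equal to `1` on the ball of radius `ε / 4`, `χ` extends the
  -- coordinates of `f` to smooth functions on `ℝ` without changing them near `x`.
  let χ : ContDiffBump (toReal V x) := ⟨ε / 4, ε / 2, by positivity, by linarith⟩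
  have hχ : ∀ (r : Fin (Module.finrank ℝ A)),
      ContDiff ℝ ∞ fun t => χ t * (Module.finBasis ℝ A).coord r (ambient f.1 t) := by
    intro r
    rw [contDiff_iff_contDiffAt]
    intro t
    by_cases ht : t ∈ Set.range (toReal V)
    · obtain ⟨y, rfl⟩ := ht
      exact χ.contDiff.contDiffAt.mul (contDiffAt_ambient f _ y)
    · have hts : t ∉ tsupport χ := fun h' => ht <| hball <| by
        rw [χ.tsupport_eq] at h'
        exact Metric.closedBall_subset_ball (by change ε / 2 < ε; linarith) h'
      refine (contDiffAt_const (c := (0 : ℝ))).congr_of_eventuallyEq ?_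
      filter_upwards [notMem_tsupport_iff_eventuallyEq.1 hts] with s hs
      rw [hs, Pi.zero_apply, zero_mul]
  choose h hs hh using fun r => exists_eq_add_sub_mul (hχ r) (toReal V x)
  let W : Opens I := ⟨{y | (y : ℝ) ∈ Metric.ball (toReal V x) (ε / 4)},
    Metric.isOpen_ball.preimage continuous_subtype_val⟩
  have hWV : W ≤ V := by
    intro y hy
    obtain ⟨z, hz⟩ := hball (Metric.ball_subset_ball (by linarith) hy)
    have : z.1 = y := Subtype.ext hz
    exact this ▸ z.2
  have hxW : x.1 ∈ W := Metric.mem_ball_self (by positivity)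
  refine ⟨W, hWV, hxW, ofReal (fun t => ∑ r, h r t • Module.finBasis ℝ A r) fun ℓ y => ?_, ?_⟩
  · simp only [map_sum, map_smul, smul_eq_mul]
    exact ContDiffAt.sum fun r _ => (hs r).contDiffAt.mul contDiffAt_const
  · ext y
    have hy : ∀ r, (Module.finBasis ℝ A).coord r (f.1 ⟨y.1, hWV y.2⟩) =
        (Module.finBasis ℝ A).coord r (f.1 x) + (toReal W y - toReal V x) * h r (toReal W y) := by
      intro r
      have h1 := hh r (toReal W y)
      have h2 : χ (toReal W y) = 1 := χ.one_of_mem_closedBall (Metric.ball_subset_closedBall y.2)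
      have h3 : χ (toReal V x) = 1 := χ.one_of_mem_closedBall
        (Metric.mem_closedBall_self χ.rIn_pos.le)
      have h4 : ambient f.1 (toReal W y) = f.1 ⟨y.1, hWV y.2⟩ :=
        ambient_apply f.1 ⟨y.1, hWV y.2⟩
      rwa [h2, h3, one_mul, one_mul, h4, ambient_apply] at h1
    change f.1 ⟨y.1, hWV y.2⟩ = f.1 x +
      (algebraMap ℝ A (toReal W y) - algebraMap ℝ A (toReal V x)) *
        ∑ r, h r (toReal W y) • Module.finBasis ℝ A r
    rw [← map_sub, ← Algebra.smul_def]
    conv_lhs => rw [← (Module.finBasis ℝ A).sum_repr (f.1 ⟨y.1, hWV y.2⟩)]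
    conv_rhs => rw [← (Module.finBasis ℝ A).sum_repr (f.1 x)]
    rw [Finset.smul_sum, ← Finset.sum_add_distrib]
    refine Finset.sum_congr rfl fun r _ => ?_
    rw [smul_smul, ← add_smul]
    exact congrArg (· • _) (hy r)

end superFun

/-! ### Super vector fields on an interval -/

section VectorFields

theorem superSign_zero_left (j : ZMod 2) : superSign 0 j = 1 := by
  rw [superSign, zero_mul, uzpow_zero, Units.val_one]

theorem superSign_zero_right (j : ZMod 2) : superSign j 0 = 1 := by
  rw [superSign, mul_zero, uzpow_zero, Units.val_one]

variable {I : Opens ℝ} {P : Type*} [Ring P] [Algebra ℝ P] [FiniteDimensional ℝ P]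
variable {𝓟 : ZMod 2 → Submodule ℝ P} [GradedAlgebra 𝓟] {U V : Opens I}

namespace IsSuperDerivation

variable {k : ZMod 2} {D : LocalOperator P U}

theorem map_one (hD : IsSuperDerivation 𝓟 k D) (hV : V ≤ U) : D ⟨V, hV⟩ 1 = 0 := by
  have h := hD.leibniz hV (j := 0) (f := 1) 1 fun _ => SetLike.GradedOne.one_mem
  rw [superSign_zero_right, one_smul, mul_one, one_mul, mul_one] at h
  exact left_eq_add.1 h

/-- For homogeneous `c`, `P`-linearity gives `D(c · 1) = ±c D(1) = 0`; a general `c` is a sum of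
homogeneous components. -/
theorem map_const (hD : IsSuperDerivation 𝓟 k D) (hV : V ≤ U) (c : P) :
    D ⟨V, hV⟩ (superFun.const V c) = 0 := by
  have h : ∀ j, D ⟨V, hV⟩ (superFun.comp 𝓟 j (superFun.const V c)) = 0 := by
    intro j
    have := hD.map_const_mul hV (c := GradedAlgebra.proj 𝓟 j c) 1 (SetLike.coe_mem _)
    rw [hD.map_one, mul_zero, zsmul_zero, mul_one] at this
    exact this
  rw [← superFun.comp_add_comp 𝓟 (superFun.const V c), hD.map_add, h, h, add_zero]

/-- Near a point `x`, Hadamard's lemma gives `f = f(x) + (t - x) g`. Applying `D` and evaluating at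
`x` leaves `(D t)(x) g(x)`, and `d/dt` leaves `g(x)`. No sign intervenes, since `t - x` is even. -/
theorem apply_eq_mul_der (hD : IsSuperDerivation 𝓟 k D) (hV : V ≤ U) (f : superFun P V) :
    D ⟨V, hV⟩ f = superFun.res hV (D ⟨U, le_rfl⟩ (superFun.coord P U)) * superFun.der V f := by
  ext x
  obtain ⟨W, hW, hx, g, hg⟩ := superFun.exists_res_eq_const_add f x
  set c := superFun.const W (algebraMap ℝ P (superFun.toReal V x)) with hc
  have hcoord : superFun.coord P W - c ∈ superFun.par 𝓟 W 0 :=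
    sub_mem (superFun.coord_mem 𝓟 W) fun _ => by
      change algebraMap ℝ P _ ∈ _
      rw [Algebra.algebraMap_eq_smul_one]
      exact Submodule.smul_mem _ _ SetLike.GradedOne.one_mem
  have hvanish : (superFun.coord P W - c).1 ⟨x.1, hx⟩ = 0 := sub_self _
  have hsub : D ⟨W, hW.trans hV⟩ (superFun.coord P W - c) =
      D ⟨W, hW.trans hV⟩ (superFun.coord P W) := by
    conv_rhs => rw [← sub_add_cancel (superFun.coord P W) c, hD.map_add, hc, hD.map_const,
      add_zero]
  have h1 : superFun.res hW (D ⟨V, hV⟩ f) = D ⟨W, hW.trans hV⟩ (superFun.coord P W) * g +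
      (superFun.coord P W - c) * D ⟨W, hW.trans hV⟩ g := by
    rw [← hD.map_res hW hV, hg, hD.map_add, hD.map_const, zero_add, hD.leibniz _ _ hcoord, hsub,
      superSign_zero_right, one_smul]
  have h2 : superFun.res hW (superFun.der V f) = g +
      (superFun.coord P W - c) * superFun.der W g := by
    rw [← superFun.der_res, hg, _root_.map_add, superFun.der_const, zero_add, superFun.der_mul,
      map_sub, superFun.der_coord, hc, superFun.der_const, sub_zero, one_mul]
  have h3 : D ⟨W, hW.trans hV⟩ (superFun.coord P W) =
      superFun.res (hW.trans hV) (D ⟨U, le_rfl⟩ (superFun.coord P U)) :=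
    hD.map_res (hW.trans hV) le_rfl (superFun.coord P U)
  have e1 : (D ⟨V, hV⟩ f).1 x = (D ⟨W, hW.trans hV⟩ (superFun.coord P W)).1 ⟨x.1, hx⟩ *
      g.1 ⟨x.1, hx⟩ + (superFun.coord P W - c).1 ⟨x.1, hx⟩ *
        (D ⟨W, hW.trans hV⟩ g).1 ⟨x.1, hx⟩ :=
    congrFun (congrArg Subtype.val h1) ⟨x.1, hx⟩
  have e2 : (superFun.der V f).1 x = g.1 ⟨x.1, hx⟩ +
      (superFun.coord P W - c).1 ⟨x.1, hx⟩ * (superFun.der W g).1 ⟨x.1, hx⟩ :=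
    congrFun (congrArg Subtype.val h2) ⟨x.1, hx⟩
  rw [hvanish, zero_mul, add_zero] at e1 e2
  rw [e1, h3]
  change _ = _ * (superFun.der V f).1 x
  rw [e2]
  rfl

end IsSuperDerivation

variable [IsSmallAlgebra 𝓟]

theorem isSuperDerivation_der (U : Opens I) :
    IsSuperDerivation 𝓟 0 (fun V => superFun.der V.1 : LocalOperator P U) where
  map_res h _ g := superFun.der_res h g
  map_par _ j g hg := by
    rw [zero_add]
    exact superFun.der_mem 𝓟 hg
  map_add _ g g' := _root_.map_add _ g g'
  map_const_mul _ j c g _ := by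
    rw [superSign_zero_left, one_smul, superFun.der_mul, superFun.der_const, zero_mul, zero_add]
  leibniz _ j f g _ := by
    rw [superSign_zero_left, one_smul, superFun.der_mul]

variable (𝓟) in
/-- The even vector field `d/dt`. -/
noncomputable def partialT (U : Opens I) : superTangent 𝓟 U :=
  ⟨fun V => superFun.der V.1, _, 0, isSuperDerivation_der U, IsSuperDerivation.zero 1,
    (add_zero _).symm⟩

theorem isSuperDerivation_partialT (U : Opens I) : IsSuperDerivation 𝓟 0 (partialT 𝓟 U).1 :=
  isSuperDerivation_der U

theorem partialT_apply (f : superFun P U) :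
    (partialT 𝓟 U).1 ⟨U, le_rfl⟩ f = superFun.der U f := rfl

theorem superTangent.res_partialT (h : U ≤ V) :
    superTangent.res h (partialT 𝓟 V) = partialT 𝓟 U := rfl

noncomputable instance superTangent.instModule (U : Opens I) : Module (superFun P U) (superTangent 𝓟 U) :=
  (superTangent 𝓟 U).module

noncomputable instance superTangent.instSMul (U : Opens I) : SMul (superFun P U) (superTangent 𝓟 U) :=
  (superTangent.instModule U).toSMul

/-- The coefficient of a vector field with respect to `d/dt`. -/
def superTangent.coeff (D : superTangent 𝓟 U) : superFun P U :=
  D.1 ⟨U, le_rfl⟩ (superFun.coord P U)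

/-- The vector field `d/dt` spans the super tangent bundle. -/
theorem superTangent.eq_smul_partialT (D : superTangent 𝓟 U) :
    D = superTangent.coeff D • partialT 𝓟 U := by
  obtain ⟨_, D₀, D₁, h₀, h₁, rfl⟩ := D
  refine Subtype.ext (funext fun V => funext fun f => ?_)
  change D₀ V f + D₁ V f = superFun.res V.2 (D₀ ⟨U, _⟩ _ + D₁ ⟨U, _⟩ _) * superFun.der V.1 f
  rw [_root_.map_add, add_mul]
  exact congrArg₂ (· + ·) (h₀.apply_eq_mul_der V.2 f) (h₁.apply_eq_mul_der V.2 f)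

end VectorFields

/-! ### Connections on trivial bundles -/

section VecMul

variable {X : Type} [TopologicalSpace X] [ChartedSpace ℝ X]
variable {A : Type*} [Ring A] [Algebra ℝ A] [FiniteDimensional ℝ A]
variable {𝒜 : ZMod 2 → Submodule ℝ A} [GradedAlgebra 𝒜] {p q : ℕ}

namespace superFun

theorem IsEvenMatrix.vecMul_mem {U : Opens X}
    {M : Matrix (Fin p ⊕ Fin q) (Fin p ⊕ Fin q) (superFun A U)}
    (hM : IsEvenMatrix 𝒜 frameParity M) {k : ZMod 2} {S : Fin p ⊕ Fin q → superFun A U}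
    (hS : ∀ l, S l ∈ par 𝒜 U (k + frameParity l)) (l : Fin p ⊕ Fin q) :
    Matrix.vecMul S M l ∈ par 𝒜 U (k + frameParity l) := by
  simp only [Matrix.vecMul, dotProduct]
  refine sum_mem fun m _ => ?_
  rw [← parity_add_add k (frameParity m)]
  exact mul_mem 𝒜 (hS m) (hM m l)

theorem res_vecMul {ι : Type*} [Fintype ι] [DecidableEq ι] {U V : Opens X} (h : U ≤ V)
    (S : ι → superFun A V) (M : Matrix ι ι (superFun A V)) (l : ι) :
    res h (Matrix.vecMul S M l) = Matrix.vecMul (fun k => res h (S k)) (matRes h M) l := by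
  simp only [Matrix.vecMul, dotProduct, map_sum, map_mul, matRes_apply]

theorem matRes_top (M : Matrix (Fin p ⊕ Fin q) (Fin p ⊕ Fin q) (superFun A (⊤ : Opens X))) :
    matRes le_top M = M := rfl

end superFun

open superFun in
/-- The automorphism of the trivial bundle given by an invertible even matrix. -/
def matrixIso {G H : Matrix (Fin p ⊕ Fin q) (Fin p ⊕ Fin q) (superFun A (⊤ : Opens X))}
    (hG : IsEvenMatrix 𝒜 frameParity G) (hGH : G * H = 1) (hHG : H * G = 1) :
    SuperIso (trivialBundle X 𝒜 p q) (trivialBundle X 𝒜 p q) ⊤ where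
  toEquiv U hU :=
    -- Sections form a left module over a noncommutative ring: matrices act on rows from the right,
    -- so as to commute with scalars.
    LinearEquiv.ofLinearMap (Matrix.vecMulLinear (matRes hU G)) (Matrix.vecMulLinear (matRes hU H))
      (LinearMap.ext fun S => by
        change Matrix.vecMul (Matrix.vecMul S (matRes hU H)) (matRes hU G) = S
        rw [Matrix.vecMul_vecMul, ← map_mul, hHG, map_one, Matrix.vecMul_one])
      (LinearMap.ext fun S => by
        change Matrix.vecMul (Matrix.vecMul S (matRes hU G)) (matRes hU H) = S
        rw [Matrix.vecMul_vecMul, ← map_mul, hGH, map_one, Matrix.vecMul_one])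
  map_res h hV S := funext fun l => (res_vecMul h S (matRes hV G) l).symm
  map_par hU _ _ hS := (hG.matRes hU).vecMul_mem hS

/-- The standard frame of the trivial bundle. -/
def stdFrame (𝒜 : ZMod 2 → Submodule ℝ A) [GradedAlgebra 𝒜] (U : Opens X)
    (k : Fin p ⊕ Fin q) : (trivialBundle X 𝒜 p q).sec U :=
  Pi.single (M := fun _ => superFun A U) k 1

theorem stdFrame_mem (U : Opens X) (k : Fin p ⊕ Fin q) :
    stdFrame 𝒜 U k ∈ (trivialBundle X 𝒜 p q).par U (frameParity k) := by
  intro l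
  rcases eq_or_ne k l with rfl | h
  · rw [stdFrame, Pi.single_eq_same, CharTwo.add_self_eq_zero]
    exact fun x => SetLike.GradedOne.one_mem
  · rw [stdFrame, Pi.single_eq_of_ne' h]
    exact AddSubgroup.zero_mem _

theorem res_stdFrame {U V : Opens X} (h : U ≤ V) (k : Fin p ⊕ Fin q) :
    (trivialBundle X 𝒜 p q).res h (stdFrame 𝒜 V k) = stdFrame 𝒜 U k := by
  funext l
  change superFun.res h (Pi.single (M := fun _ => superFun A V) k 1 l) =
    Pi.single (M := fun _ => superFun A U) k 1 l
  rcases eq_or_ne k l with rfl | hkl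
  · rw [Pi.single_eq_same, Pi.single_eq_same, map_one]
  · rw [Pi.single_eq_of_ne' hkl, Pi.single_eq_of_ne' hkl, map_zero]

theorem sum_smul_stdFrame {U : Opens X} (S : (trivialBundle X 𝒜 p q).sec U) :
    ∑ k, S k • stdFrame 𝒜 U k = S := by
  funext l
  simp [stdFrame, Finset.sum_apply, Pi.single_apply]

end VecMul

/-! ### Parallel frames and parallel transport -/

section Parallel

variable {I : Opens ℝ} {P : Type*} [Ring P] [Algebra ℝ P] [FiniteDimensional ℝ P]
variable {𝓟 : ZMod 2 → Submodule ℝ P} [GradedAlgebra 𝓟] [IsSmallAlgebra 𝓟] {U V : Opens I}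

theorem SuperConnection.apply_eq_coeff_smul {E : SuperModuleSheaf I 𝓟} (nabla : SuperConnection E)
    (S : E.sec U) (D : superTangent 𝓟 U) :
    nabla.toFun U S D = superTangent.coeff D • nabla.toFun U S (partialT 𝓟 U) := by
  conv_lhs => rw [superTangent.eq_smul_partialT D]
  rw [map_smul]

/-- The Leibniz rule is postulated for homogeneous `f`; as `d/dt` is even, its sign is `1` for both
components, and they add up. -/
theorem SuperConnection.smul_partialT {E : SuperModuleSheaf I 𝓟} (nabla : SuperConnection E)
    (f : superFun P U) (S : E.sec U) :
    nabla.toFun U (f • S) (partialT 𝓟 U) =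
      superFun.der U f • S + f • nabla.toFun U S (partialT 𝓟 U) := by
  have h : ∀ j, nabla.toFun U (superFun.comp 𝓟 j f • S) (partialT 𝓟 U) =
      superFun.der U (superFun.comp 𝓟 j f) • S +
        superFun.comp 𝓟 j f • nabla.toFun U S (partialT 𝓟 U) := by
    intro j
    rw [nabla.leibniz S (superFun.comp_mem 𝓟 j f) (isSuperDerivation_partialT U),
      superSign_zero_left, one_smul, partialT_apply]
  rw [← superFun.comp_add_comp 𝓟 f, add_smul, map_add, LinearMap.add_apply, h, h, map_add,
    add_smul, add_smul]
  abel

variable {p q : ℕ}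

open superFun

/-- The matrix of the covariant derivative along `d/dt` in the standard frame. -/
noncomputable def connectionMatrix (nabla : SuperConnection (trivialBundle I 𝓟 p q)) :
    Matrix (Fin p ⊕ Fin q) (Fin p ⊕ Fin q) (superFun P (⊤ : Opens I)) :=
  fun k => nabla.toFun ⊤ (stdFrame 𝓟 ⊤ k) (partialT 𝓟 ⊤)

theorem isEvenMatrix_connectionMatrix (nabla : SuperConnection (trivialBundle I 𝓟 p q)) :
    IsEvenMatrix 𝓟 frameParity (connectionMatrix nabla) := by
  intro k l
  have h := nabla.map_par (stdFrame_mem (𝒜 := 𝓟) ⊤ k) (isSuperDerivation_partialT (⊤ : Opens I)) l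
  rwa [zero_add] at h

/-- The standard frame over `U` is the restriction of the global one, so a single global matrix `Γ`
describes `∇` over every `U`. -/
theorem SuperConnection.partialT_eq (nabla : SuperConnection (trivialBundle I 𝓟 p q))
    (S : (trivialBundle I 𝓟 p q).sec U) :
    nabla.toFun U S (partialT 𝓟 U) =
      (fun l => der U (S l)) + Matrix.vecMul S (matRes le_top (connectionMatrix nabla)) := by
  have hΓ : ∀ k, nabla.toFun U (stdFrame 𝓟 U k) (partialT 𝓟 U) =
      fun l => res le_top (connectionMatrix nabla k l) := by
    intro k
    have := nabla.map_res (le_top : U ≤ ⊤) (stdFrame 𝓟 ⊤ k) (partialT 𝓟 ⊤)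
    rwa [res_stdFrame, superTangent.res_partialT] at this
  conv_lhs => rw [← sum_smul_stdFrame S, map_sum, LinearMap.sum_apply]
  simp only [nabla.smul_partialT, hΓ]
  rw [Finset.sum_add_distrib]
  congr 1
  · exact sum_smul_stdFrame (𝒜 := 𝓟) (fun l => der U (S l))
  · funext l
    simp [Matrix.vecMul, dotProduct, Finset.sum_apply]

theorem der_vecMul {ι : Type*} [Fintype ι] [DecidableEq ι] (S : ι → superFun P U)
    (M : Matrix ι ι (superFun P U)) :
    (fun l => der U (Matrix.vecMul S M l)) =
      Matrix.vecMul (fun k => der U (S k)) M + Matrix.vecMul S (matDer M) := by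
  funext l
  simp only [Matrix.vecMul, dotProduct, map_sum, der_mul, Finset.sum_add_distrib, Pi.add_apply,
    matDer, Matrix.map_apply]

/-- In a suitable frame, the covariant derivative is the componentwise derivative. -/
theorem SuperConnection.exists_parallel_frame (hI : (I : Set ℝ).OrdConnected)
    (nabla : SuperConnection (trivialBundle I 𝓟 p q)) :
    ∃ G H : Matrix (Fin p ⊕ Fin q) (Fin p ⊕ Fin q) (superFun P (⊤ : Opens I)),
      IsEvenMatrix 𝓟 frameParity G ∧ IsEvenMatrix 𝓟 frameParity H ∧ G * H = 1 ∧ H * G = 1 ∧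
      ∀ (U : Opens I) (S : (trivialBundle I 𝓟 p q).sec U),
        nabla.toFun U (Matrix.vecMul S (matRes le_top G)) (partialT 𝓟 U) =
          Matrix.vecMul (fun k => der U (S k)) (matRes le_top G) := by
  obtain ⟨G, H, hG, hH, hGH, hHG, hdG, -⟩ :=
    exists_fundamental hI (isEvenMatrix_connectionMatrix nabla)
  refine ⟨G, H, hG, hH, hGH, hHG, fun U S => ?_⟩
  rw [nabla.partialT_eq, der_vecMul, matDer_matRes, hdG, map_neg, map_mul, Matrix.vecMul_neg,
    Matrix.vecMul_vecMul, neg_add_cancel_right]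

/-- Both covariant derivatives are linear in the vector field, so `d/dt` alone has to be checked. -/
theorem SuperConnection.exists_parallel_superIso (hI : (I : Set ℝ).OrdConnected)
    (nabla : SuperConnection (trivialBundle I 𝓟 p q)) :
    ∃ φ : SuperIso (trivialBundle I 𝓟 p q) (trivialBundle I 𝓟 p q) ⊤,
      φ.IsParallel (trivialConnection I 𝓟 p q) nabla := by
  obtain ⟨G, H, hG, -, hGH, hHG, h⟩ := nabla.exists_parallel_frame hI
  refine ⟨matrixIso hG hGH hHG, fun U S D => ?_⟩
  rw [nabla.apply_eq_coeff_smul, (trivialConnection I 𝓟 p q).apply_eq_coeff_smul, map_smul]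
  exact congrArg _ (h U S)

theorem SuperPoint.pullback_const (t₀ : SuperPoint I 𝓟) (hU : t₀.pt ∈ U) (c : P) :
    t₀.pullback U hU (const U c) = c := by
  have h := t₀.map_const_mul hU c 1
  rwa [mul_one, map_one, mul_one] at h

/-- The pullback of a matrix of superfunctions to a `P`-point. -/
noncomputable def SuperPoint.matPullback {ι : Type*} [Fintype ι] [DecidableEq ι] (t₀ : SuperPoint I 𝓟) :
    Matrix ι ι (superFun P (⊤ : Opens I)) →+* Matrix ι ι P :=
  (t₀.pullback ⊤ trivial).mapMatrix

theorem SuperPoint.eval_vecMul (t₀ : SuperPoint I 𝓟) (S : (trivialBundle I 𝓟 p q).sec ⊤)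
    (M : Matrix (Fin p ⊕ Fin q) (Fin p ⊕ Fin q) (superFun P (⊤ : Opens I))) :
    t₀.eval (Matrix.vecMul S M) = Matrix.vecMul (t₀.eval S) (t₀.matPullback M) := by
  funext l
  simp [SuperPoint.eval, Matrix.vecMul, dotProduct, SuperPoint.matPullback]

/-- The section of the trivial bundle with constant components. -/
noncomputable def constSection (𝓟 : ZMod 2 → Submodule ℝ P) [GradedAlgebra 𝓟] (U : Opens I)
    (c : Fin p ⊕ Fin q → P) : (trivialBundle I 𝓟 p q).sec U :=
  fun k => const U (c k)

theorem SuperPoint.eval_constSection (t₀ : SuperPoint I 𝓟) (c : Fin p ⊕ Fin q → P) :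
    t₀.eval (constSection 𝓟 ⊤ c) = c :=
  funext fun k => t₀.pullback_const _ (c k)

theorem eq_constSection_of_der_eq_zero (hI : (I : Set ℝ).OrdConnected)
    {S : (trivialBundle I 𝓟 p q).sec ⊤} (hS : ∀ k, der ⊤ (S k) = 0) (x : (⊤ : Opens I)) :
    S = constSection 𝓟 ⊤ (fun k => (S k).1 x) := by
  funext k
  ext y
  exact eq_of_der_eq_zero (isPreconnected_univ_top hI) (hS k) y x

theorem constSection_add (v w : Fin p ⊕ Fin q → P) :
    constSection 𝓟 U (v + w) = constSection 𝓟 U v + constSection 𝓟 U w :=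
  funext fun k => map_add (const U) (v k) (w k)

theorem constSection_smul (c : P) (v : Fin p ⊕ Fin q → P) :
    constSection 𝓟 U (c • v) = const U c • constSection 𝓟 U v :=
  funext fun k => map_mul (const U) c (v k)

theorem constSection_mem {k : ZMod 2} {v : Fin p ⊕ Fin q → P} (hv : v ∈ freePar 𝓟 p q k) :
    constSection 𝓟 U v ∈ (trivialBundle I 𝓟 p q).par U k :=
  fun l _ => hv l

theorem vecMul_mem_freePar {k : ZMod 2} {v : Fin p ⊕ Fin q → P} (hv : v ∈ freePar 𝓟 p q k)
    {M : Matrix (Fin p ⊕ Fin q) (Fin p ⊕ Fin q) P}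
    (hM : ∀ k l, M k l ∈ 𝓟 (frameParity k + frameParity l)) :
    Matrix.vecMul v M ∈ freePar 𝓟 p q k := by
  intro l
  simp only [Matrix.vecMul, dotProduct]
  refine sum_mem fun m _ => ?_
  rw [← parity_add_add k (frameParity m)]
  exact SetLike.GradedMul.mul_mem (hv m) (hM m l)

theorem vecMul_constSection_add (v w : Fin p ⊕ Fin q → P)
    (M : Matrix (Fin p ⊕ Fin q) (Fin p ⊕ Fin q) P)
    (G : Matrix (Fin p ⊕ Fin q) (Fin p ⊕ Fin q) (superFun P U)) :
    Matrix.vecMul (constSection 𝓟 U (Matrix.vecMul (v + w) M)) G =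
      Matrix.vecMul (constSection 𝓟 U (Matrix.vecMul v M)) G +
        Matrix.vecMul (constSection 𝓟 U (Matrix.vecMul w M)) G := by
  rw [Matrix.add_vecMul, constSection_add, Matrix.add_vecMul]

theorem vecMul_constSection_smul (c : P) (v : Fin p ⊕ Fin q → P)
    (M : Matrix (Fin p ⊕ Fin q) (Fin p ⊕ Fin q) P)
    (G : Matrix (Fin p ⊕ Fin q) (Fin p ⊕ Fin q) (superFun P U)) :
    Matrix.vecMul (constSection 𝓟 U (Matrix.vecMul (c • v) M)) G =
      const U c • Matrix.vecMul (constSection 𝓟 U (Matrix.vecMul v M)) G := by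
  rw [Matrix.smul_vecMul, constSection_smul, Matrix.smul_vecMul]

/-- If `S` is parallel, then `(SH)' G = 0`, so `SH` is a constant row. Pullback to `t₀` fixes
constants, which identifies this row as `v H(t₀)`. -/
theorem eq_of_parallel_of_eval (hI : (I : Set ℝ).OrdConnected)
    {nabla : SuperConnection (trivialBundle I 𝓟 p q)} {t₀ : SuperPoint I 𝓟}
    {G H : Matrix (Fin p ⊕ Fin q) (Fin p ⊕ Fin q) (superFun P (⊤ : Opens I))}
    (hGH : G * H = 1) (hHG : H * G = 1)
    (h : ∀ (U : Opens I) (S : (trivialBundle I 𝓟 p q).sec U),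
      nabla.toFun U (Matrix.vecMul S (matRes le_top G)) (partialT 𝓟 U) =
        Matrix.vecMul (fun k => der U (S k)) (matRes le_top G))
    {S : (trivialBundle I 𝓟 p q).sec ⊤} (hS : nabla.IsParallelSection S)
    {v : Fin p ⊕ Fin q → P} (hv : t₀.eval S = v) :
    S = Matrix.vecMul (constSection 𝓟 ⊤ (Matrix.vecMul v (t₀.matPullback H))) G := by
  have hSG : Matrix.vecMul (Matrix.vecMul S H) G = S := by
    rw [Matrix.vecMul_vecMul, hHG, Matrix.vecMul_one]
  have h0 : nabla.toFun ⊤ S = 0 := hS ⊤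
  have h1 := h ⊤ (Matrix.vecMul S H)
  rw [matRes_top, hSG, h0, LinearMap.zero_apply] at h1
  have h2 : (fun k => der ⊤ (Matrix.vecMul S H k)) = 0 := by
    rw [← Matrix.vecMul_one (fun k => der ⊤ (Matrix.vecMul S H k)), ← hGH,
      ← Matrix.vecMul_vecMul, ← h1]
    exact Matrix.zero_vecMul _
  obtain ⟨c, hc⟩ : ∃ c, Matrix.vecMul S H = constSection 𝓟 ⊤ c :=
    ⟨_, eq_constSection_of_der_eq_zero hI (fun k => congrFun h2 k) ⟨t₀.pt, trivial⟩⟩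
  have h4 : t₀.eval (Matrix.vecMul S H) = c := by rw [hc, t₀.eval_constSection]
  rw [t₀.eval_vecMul, hv] at h4
  rw [h4, ← hc, hSG]

theorem SuperConnection.exists_parallel_transport (hI : (I : Set ℝ).OrdConnected)
    (nabla : SuperConnection (trivialBundle I 𝓟 p q)) (t₀ : SuperPoint I 𝓟) :
    ∃ τ : (Fin p ⊕ Fin q → P) → (trivialBundle I 𝓟 p q).sec ⊤,
      ((∀ v, t₀.eval (τ v) = v) ∧ ∀ v, nabla.IsParallelSection (τ v)) ∧
      (∀ τ' : (Fin p ⊕ Fin q → P) → (trivialBundle I 𝓟 p q).sec ⊤,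
        ((∀ v, t₀.eval (τ' v) = v) ∧ ∀ v, nabla.IsParallelSection (τ' v)) → τ' = τ) ∧
      (∀ v w, τ (v + w) = τ v + τ w) ∧
      (∀ (c : P) v, τ (c • v) = superFun.const (⊤ : Opens I) c • τ v) ∧
      (∀ (k : ZMod 2) v, v ∈ freePar 𝓟 p q k → τ v ∈ (trivialBundle I 𝓟 p q).par ⊤ k) := by
  obtain ⟨G, H, hG, hH, hGH, hHG, h⟩ := nabla.exists_parallel_frame hI
  have hpGH : t₀.matPullback G * t₀.matPullback H = 1 := by rw [← map_mul, hGH, map_one]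
  have hpHG : t₀.matPullback H * t₀.matPullback G = 1 := by rw [← map_mul, hHG, map_one]
  have hpH : ∀ k l, t₀.matPullback H k l ∈ 𝓟 (frameParity k + frameParity l) :=
    fun k l => t₀.map_par _ (hH k l)
  -- The constant row `v H(t₀)` is chosen so that its product with `G(t₀)` is `v`.
  refine ⟨fun v => Matrix.vecMul (constSection 𝓟 ⊤ (Matrix.vecMul v (t₀.matPullback H))) G,
    ⟨fun v => ?_, fun v U => ?_⟩, fun τ' hτ' => ?_, fun v w => ?_, fun c v => ?_,
    fun k v hv => ?_⟩
  · rw [t₀.eval_vecMul, t₀.eval_constSection, Matrix.vecMul_vecMul, hpHG, Matrix.vecMul_one]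
  · refine LinearMap.ext fun D => ?_
    have hres : (trivialBundle I 𝓟 p q).res (le_top : U ≤ ⊤)
        (Matrix.vecMul (constSection 𝓟 ⊤ (Matrix.vecMul v (t₀.matPullback H))) G) =
        Matrix.vecMul (constSection 𝓟 U (Matrix.vecMul v (t₀.matPullback H)))
          (matRes le_top G) := funext fun l => res_vecMul _ _ _ l
    have hder : (fun k => der U (constSection 𝓟 U (Matrix.vecMul v (t₀.matPullback H)) k)) = 0 :=
      funext fun k => der_const _
    rw [hres, nabla.apply_eq_coeff_smul, h, hder, Matrix.zero_vecMul, smul_zero,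
      LinearMap.zero_apply]
  · funext v
    exact eq_of_parallel_of_eval hI hGH hHG h (hτ'.2 v) (hτ'.1 v)
  · exact vecMul_constSection_add v w _ _
  · exact vecMul_constSection_smul c v _ _
  · exact hG.vecMul_mem (constSection_mem (vecMul_mem_freePar hv hpH))

end Parallel

/-! ### Frames of sheaves of graded modules -/

section Frames

variable {X : Type} [TopologicalSpace X] [ChartedSpace ℝ X]
variable {A : Type u} [Ring A] [Algebra ℝ A] [FiniteDimensional ℝ A]
variable {𝒜 : ZMod 2 → Submodule ℝ A}

namespace SuperModuleSheaf

variable {E : SuperModuleSheaf.{u, v} X 𝒜} {κ : Type}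

theorem sec_ext {U : Opens X} {W : κ → Opens X} (hW : ∀ i, W i ≤ U) (hU : U ≤ ⨆ i, W i)
    {s t : E.sec U} (h : ∀ i, E.res (hW i) s = E.res (hW i) t) : s = t := by
  obtain rfl : U = ⨆ i, W i := le_antisymm hU (iSup_le hW)
  refine (E.glue W (fun i => E.res (hW i) t) fun i j => ?_).unique h fun i => rfl
  rw [E.res_res, E.res_res]

theorem exists_glue {U : Opens X} {W : κ → Opens X} (hW : ∀ i, W i ≤ U) (hU : U ≤ ⨆ i, W i)
    (s : ∀ i, E.sec (W i)) (h : ∀ i j, E.res (inf_le_left : W i ⊓ W j ≤ W i) (s i) =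
      E.res (inf_le_right : W i ⊓ W j ≤ W j) (s j)) :
    ∃ t : E.sec U, ∀ i, E.res (hW i) t = s i := by
  obtain rfl : U = ⨆ i, W i := le_antisymm hU (iSup_le hW)
  exact (E.glue W s h).exists

theorem exists_add (U : Opens X) (k : ZMod 2) (s : E.sec U) :
    ∃ s₀ ∈ E.par U k, ∃ s₁ ∈ E.par U (k + 1), s₀ + s₁ = s := by
  have h := E.isCompl_par U
  have hk : IsCompl (E.par U k) (E.par U (k + 1)) := by
    fin_cases k
    · exact h
    · exact h.symm
  exact AddSubgroup.mem_sup.1 (hk.sup_eq_top ▸ AddSubgroup.mem_top s)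

theorem eq_zero_of_mem {U : Opens X} {k : ZMod 2} {s : E.sec U} (h₀ : s ∈ E.par U k)
    (h₁ : s ∈ E.par U (k + 1)) : s = 0 := by
  have h := (E.isCompl_par U).disjoint
  have hk : Disjoint (E.par U k) (E.par U (k + 1)) := by
    fin_cases k
    · exact h
    · exact h.symm
  exact AddSubgroup.disjoint_def.1 hk h₀ h₁

/-- The component of the wrong parity restricts to zero on each `W i`, hence vanishes by the sheaf
condition. -/
theorem mem_par_of_local {U : Opens X} {W : κ → Opens X} (hW : ∀ i, W i ≤ U)
    (hU : U ≤ ⨆ i, W i) {k : ZMod 2} {s : E.sec U} (h : ∀ i, E.res (hW i) s ∈ E.par (W i) k) :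
    s ∈ E.par U k := by
  obtain ⟨s₀, h₀, s₁, h₁, rfl⟩ := exists_add U k s
  have : s₁ = 0 := sec_ext hW hU fun i => by
    rw [map_zero]
    refine eq_zero_of_mem ?_ (E.res_mem (hW i) h₁)
    have hi := sub_mem (h i) (E.res_mem (hW i) h₀)
    rwa [map_add, add_sub_cancel_left] at hi
  rwa [this, add_zero]

/-- An additive isomorphism preserving parities reflects parities. -/
theorem mem_par_of_map {F : SuperModuleSheaf X 𝒜} {U : Opens X} (e : E.sec U →+ F.sec U)
    (he : Function.Injective e) (hpar : ∀ {k : ZMod 2} {s : E.sec U}, s ∈ E.par U k →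
      e s ∈ F.par U k) {k : ZMod 2} {s : E.sec U} (hs : e s ∈ F.par U k) : s ∈ E.par U k := by
  obtain ⟨s₀, h₀, s₁, h₁, rfl⟩ := exists_add U k s
  have : s₁ = 0 := he <| by
    rw [map_zero]
    refine eq_zero_of_mem ?_ (hpar h₁)
    have hi := sub_mem hs (hpar h₀)
    rwa [map_add, add_sub_cancel_left] at hi
  rwa [this, add_zero]

variable {p q : ℕ} {U V W : Opens X}

/-- The linear combinations of a tuple of sections. -/
abbrev lin (s : Fin p ⊕ Fin q → E.sec U) :
    (Fin p ⊕ Fin q → superFun A U) →ₗ[superFun A U] E.sec U :=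
  Fintype.linearCombination (superFun A U) s

/-- Restriction of a tuple of sections. -/
def resTuple (h : U ≤ V) (s : Fin p ⊕ Fin q → E.sec V) : Fin p ⊕ Fin q → E.sec U :=
  fun k => E.res h (s k)

theorem resTuple_resTuple (h : U ≤ V) (h' : V ≤ W) (s : Fin p ⊕ Fin q → E.sec W) :
    resTuple h (resTuple h' s) = resTuple (h.trans h') s :=
  funext fun _ => E.res_res _ _ _

theorem resTuple_self (s : Fin p ⊕ Fin q → E.sec U) : resTuple le_rfl s = s :=
  funext fun _ => E.res_self _

theorem res_lin (h : U ≤ V) (s : Fin p ⊕ Fin q → E.sec V) (c : Fin p ⊕ Fin q → superFun A V) :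
    E.res h (lin s c) = lin (resTuple h s) fun k => superFun.res h (c k) := by
  simp only [lin, Fintype.linearCombination_apply, map_sum, E.res_smul, resTuple]

/-- Change of a tuple of sections by a matrix. -/
def matAct (M : Matrix (Fin p ⊕ Fin q) (Fin p ⊕ Fin q) (superFun A U))
    (s : Fin p ⊕ Fin q → E.sec U) : Fin p ⊕ Fin q → E.sec U :=
  fun k => lin s (M k)

theorem lin_matAct (M : Matrix (Fin p ⊕ Fin q) (Fin p ⊕ Fin q) (superFun A U))
    (s : Fin p ⊕ Fin q → E.sec U) (c : Fin p ⊕ Fin q → superFun A U) :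
    lin (matAct M s) c = lin s (Matrix.vecMul c M) := by
  simp only [lin, matAct, Fintype.linearCombination_apply, Matrix.vecMul, dotProduct,
    Finset.smul_sum, Finset.sum_smul, smul_smul]
  exact Finset.sum_comm

theorem matAct_mul (M N : Matrix (Fin p ⊕ Fin q) (Fin p ⊕ Fin q) (superFun A U))
    (s : Fin p ⊕ Fin q → E.sec U) : matAct (M * N) s = matAct M (matAct N s) :=
  funext fun k => (lin_matAct N s (M k)).symm

theorem matAct_one (s : Fin p ⊕ Fin q → E.sec U) : matAct 1 s = s := by
  funext k
  simp [matAct, lin, Fintype.linearCombination_apply, Matrix.one_apply, ite_smul]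

theorem resTuple_matAct (h : U ≤ V)
    (M : Matrix (Fin p ⊕ Fin q) (Fin p ⊕ Fin q) (superFun A V)) (s : Fin p ⊕ Fin q → E.sec V) :
    resTuple h (matAct M s) = matAct (superFun.matRes h M) (resTuple h s) :=
  funext fun k => res_lin h s (M k)

theorem lin_mem {s : Fin p ⊕ Fin q → E.sec U} (hs : ∀ k, s k ∈ E.par U (frameParity k))
    {k : ZMod 2} {c : Fin p ⊕ Fin q → superFun A U}
    (hc : ∀ l, c l ∈ superFun.par 𝒜 U (k + frameParity l)) : lin s c ∈ E.par U k := by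
  rw [lin, Fintype.linearCombination_apply]
  refine sum_mem fun l _ => ?_
  have h := E.smul_mem (hc l) (hs l)
  rwa [add_assoc, CharTwo.add_self_eq_zero, add_zero] at h

/-- A tuple of `p` even and `q` odd sections over `W` is a frame if it is a basis of the sections
over each open subset of `W`. -/
structure IsFrame (s : Fin p ⊕ Fin q → E.sec W) : Prop where
  mem_par : ∀ k, s k ∈ E.par W (frameParity k)
  bijective : ∀ (U : Opens X) (h : U ≤ W), Function.Bijective (lin (resTuple h s))

theorem IsFrame.resTuple {s : Fin p ⊕ Fin q → E.sec V} (hs : IsFrame s) (h : U ≤ V) :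
    IsFrame (resTuple h s) where
  mem_par k := E.res_mem h (hs.mem_par k)
  bijective U' h' := by
    rw [resTuple_resTuple]
    exact hs.bijective U' _

theorem IsFrame.lin_bijective {s : Fin p ⊕ Fin q → E.sec U} (hs : IsFrame s) :
    Function.Bijective (lin s) := by
  have h := hs.bijective U le_rfl
  rwa [resTuple_self] at h

theorem IsFrame.matAct {s : Fin p ⊕ Fin q → E.sec W} (hs : IsFrame s)
    {M N : Matrix (Fin p ⊕ Fin q) (Fin p ⊕ Fin q) (superFun A W)}
    (hM : superFun.IsEvenMatrix 𝒜 frameParity M) (hMN : M * N = 1) (hNM : N * M = 1) :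
    IsFrame (matAct M s) where
  mem_par k := lin_mem hs.mem_par (hM k)
  bijective U h := by
    have h1 : superFun.matRes h M * superFun.matRes h N = 1 := by rw [← map_mul, hMN, map_one]
    have h2 : superFun.matRes h N * superFun.matRes h M = 1 := by rw [← map_mul, hNM, map_one]
    have hcomp : ⇑(lin (SuperModuleSheaf.resTuple h (SuperModuleSheaf.matAct M s))) =
        lin (SuperModuleSheaf.resTuple h s) ∘
          fun c => Matrix.vecMul c (superFun.matRes h M) := by
      funext c
      rw [resTuple_matAct, lin_matAct]
      rfl
    rw [hcomp]
    refine (hs.bijective U h).comp (Function.bijective_iff_has_inverse.2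
      ⟨fun c => Matrix.vecMul c (superFun.matRes h N), fun c => ?_, fun c => ?_⟩)
    · simp only [Matrix.vecMul_vecMul, h1, Matrix.vecMul_one]
    · simp only [Matrix.vecMul_vecMul, h2, Matrix.vecMul_one]

theorem IsFrame.matAct_injective {s : Fin p ⊕ Fin q → E.sec U} (hs : IsFrame s)
    {M N : Matrix (Fin p ⊕ Fin q) (Fin p ⊕ Fin q) (superFun A U)}
    (h : SuperModuleSheaf.matAct M s = SuperModuleSheaf.matAct N s) : M = N :=
  funext fun k => hs.lin_bijective.1 (congrFun h k)

variable [GradedAlgebra 𝒜]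

/-- The coefficient map of a frame is injective and preserves parity, hence also reflects it. -/
theorem IsFrame.mem_par_of_lin_mem {s : Fin p ⊕ Fin q → E.sec U} (hs : IsFrame s) {k : ZMod 2}
    {c : Fin p ⊕ Fin q → superFun A U} (hc : lin s c ∈ E.par U k) :
    c ∈ (trivialBundle X 𝒜 p q).par U k :=
  mem_par_of_map (E := trivialBundle X 𝒜 p q) (F := E) (lin s).toAddMonoidHom
    hs.lin_bijective.1 (fun h => lin_mem hs.mem_par h) hc

/-- Two frames differ by an invertible even matrix. -/
theorem IsFrame.exists_transition {s t : Fin p ⊕ Fin q → E.sec U} (hs : IsFrame s)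
    (ht : IsFrame t) : ∃ g h : Matrix (Fin p ⊕ Fin q) (Fin p ⊕ Fin q) (superFun A U),
      superFun.IsEvenMatrix 𝒜 frameParity g ∧ superFun.IsEvenMatrix 𝒜 frameParity h ∧
      g * h = 1 ∧ h * g = 1 ∧ SuperModuleSheaf.matAct g t = s := by
  choose g hg using fun k => ht.lin_bijective.2 (s k)
  choose h hh using fun k => hs.lin_bijective.2 (t k)
  have hgt : SuperModuleSheaf.matAct g t = s := funext hg
  have hhs : SuperModuleSheaf.matAct h s = t := funext hh
  refine ⟨g, h, fun k => ht.mem_par_of_lin_mem ?_, fun k => hs.mem_par_of_lin_mem ?_,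
    hs.matAct_injective ?_, ht.matAct_injective ?_, hgt⟩
  · rw [hg]
    exact hs.mem_par k
  · rw [hh]
    exact ht.mem_par k
  · exact (matAct_mul g h s).trans (by rw [hhs, hgt, matAct_one])
  · exact (matAct_mul h g t).trans (by rw [hgt, hhs, matAct_one])

/-- Coefficients are sections of the trivial bundle, itself a sheaf. Being unique, the local
coefficients of a section agree on overlaps and glue. -/
theorem IsFrame.of_local {s : Fin p ⊕ Fin q → E.sec W} {V : κ → Opens X} (hV : ∀ i, V i ≤ W)
    (hW : W ≤ ⨆ i, V i) (hs : ∀ i, IsFrame (SuperModuleSheaf.resTuple (hV i) s)) :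
    IsFrame s where
  mem_par k := mem_par_of_local hV hW fun i => (hs i).mem_par k
  bijective U hU := by
    have hle : ∀ i, U ⊓ V i ≤ U := fun i => inf_le_left
    have hcov : U ≤ ⨆ i, U ⊓ V i := by
      rw [← inf_iSup_eq]
      exact le_inf le_rfl (hU.trans hW)
    have hb : ∀ (U' : Opens X) (i : κ) (hi : U' ≤ V i),
        Function.Bijective (lin (SuperModuleSheaf.resTuple (hi.trans (hV i)) s)) := by
      intro U' i hi
      have := (hs i).bijective U' hi
      rwa [resTuple_resTuple] at this
    constructor
    · intro c d hcd
      refine sec_ext (E := trivialBundle X 𝒜 p q) hle hcov fun i => ?_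
      refine (hb (U ⊓ V i) i inf_le_right).1 ?_
      have := congrArg (E.res (hle i)) hcd
      rwa [res_lin, res_lin, resTuple_resTuple] at this
    · intro t
      choose c hc using fun i => (hb (U ⊓ V i) i inf_le_right).2 (E.res (hle i) t)
      obtain ⟨d, hd⟩ := exists_glue (E := trivialBundle X 𝒜 p q) hle hcov c fun i j => by
        refine (hb (U ⊓ V i ⊓ (U ⊓ V j)) i (inf_le_left.trans inf_le_right)).1 ?_
        have hi := congrArg (E.res (inf_le_left : U ⊓ V i ⊓ (U ⊓ V j) ≤ U ⊓ V i)) (hc i)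
        have hj := congrArg (E.res (inf_le_right : U ⊓ V i ⊓ (U ⊓ V j) ≤ U ⊓ V j)) (hc j)
        rw [res_lin, resTuple_resTuple, E.res_res] at hi hj
        exact hi.trans hj.symm
      refine ⟨d, sec_ext hle hcov fun i => ?_⟩
      rw [res_lin, resTuple_resTuple, ← hc i]
      exact congrArg _ (hd i)

/-- Compatible local frames glue. -/
theorem exists_isFrame_iSup (V : κ → Opens X) (s : ∀ i, Fin p ⊕ Fin q → E.sec (V i))
    (hs : ∀ i, IsFrame (s i))
    (hc : ∀ i j, resTuple (inf_le_left : V i ⊓ V j ≤ V i) (s i) =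
      resTuple (inf_le_right : V i ⊓ V j ≤ V j) (s j)) :
    ∃ t : Fin p ⊕ Fin q → E.sec (⨆ i, V i), IsFrame t := by
  choose t ht using fun k => (E.glue V (fun i => s i k) fun i j => congrFun (hc i j) k).exists
  refine ⟨t, IsFrame.of_local (le_iSup V) le_rfl fun i => ?_⟩
  have : resTuple (le_iSup V i) t = s i := funext fun k => ht k i
  rw [this]
  exact hs i

/-- A frame trivializes the sheaf. -/
noncomputable def IsFrame.superIso {s : Fin p ⊕ Fin q → E.sec W} (hs : IsFrame s) :
    SuperIso E (trivialBundle X 𝒜 p q) W where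
  toEquiv U h := (LinearEquiv.ofBijective (lin (SuperModuleSheaf.resTuple h s))
    (hs.bijective U h)).symm
  map_res {U V} h hV t := by
    rw [LinearEquiv.symm_apply_eq]
    have ht := (LinearEquiv.ofBijective (lin (SuperModuleSheaf.resTuple hV s))
      (hs.bijective V hV)).apply_symm_apply t
    conv_lhs => rw [← ht]
    refine (res_lin h _ _).trans ?_
    rw [resTuple_resTuple]
    rfl
  map_par {U} hU k t ht := by
    refine (hs.resTuple hU).mem_par_of_lin_mem ?_
    have h := (LinearEquiv.ofBijective (lin (SuperModuleSheaf.resTuple hU s))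
      (hs.bijective U hU)).apply_symm_apply t
    rw [LinearEquiv.ofBijective_apply] at h
    rwa [h]

/-- A trivialization gives a frame. -/
theorem exists_isFrame_of_superIso (φ : SuperIso E (trivialBundle X 𝒜 p q) W) :
    ∃ s : Fin p ⊕ Fin q → E.sec W, IsFrame s := by
  let s : Fin p ⊕ Fin q → E.sec W := fun k => (φ.toEquiv W le_rfl).symm (stdFrame 𝒜 W k)
  have hres : ∀ (U : Opens X) (h : U ≤ W) (k : Fin p ⊕ Fin q),
      φ.toEquiv U h (E.res h (s k)) = stdFrame 𝒜 U k := by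
    intro U h k
    have := φ.map_res h le_rfl (s k)
    rw [LinearEquiv.apply_symm_apply, res_stdFrame] at this
    exact this
  refine ⟨s, fun k => ?_, fun U h => ?_⟩
  · refine mem_par_of_map (F := trivialBundle X 𝒜 p q)
      (φ.toEquiv W le_rfl).toLinearMap.toAddMonoidHom (φ.toEquiv W le_rfl).injective
      (φ.map_par le_rfl) ?_
    have : φ.toEquiv W le_rfl (s k) = stdFrame 𝒜 W k := LinearEquiv.apply_symm_apply _ _
    change φ.toEquiv W le_rfl (s k) ∈ _
    rw [this]
    exact stdFrame_mem W k
  -- The frame is the preimage of the standard one, so forming linear combinations inverts the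
  -- trivialization.
  · have hlin : ∀ c, φ.toEquiv U h (lin (resTuple h s) c) = c := by
      intro c
      rw [lin, Fintype.linearCombination_apply, map_sum]
      simp only [map_smul, resTuple, hres]
      exact sum_smul_stdFrame c
    refine ⟨fun c d hcd => ?_, fun t => ⟨φ.toEquiv U h t, (φ.toEquiv U h).injective (hlin _)⟩⟩
    rw [← hlin c, hcd, hlin d]

end SuperModuleSheaf

end Frames

/-! ### Super vector bundles on an interval -/

section Interval

open superFun

variable {I : Opens ℝ} {A : Type u} [Ring A] [Algebra ℝ A] [FiniteDimensional ℝ A]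
variable {𝒜 : ZMod 2 → Submodule ℝ A} [GradedAlgebra 𝒜] {p q : ℕ}

namespace superFun

/-- Cutoff: near a compact set, a local superfunction agrees with a global one. -/
theorem exists_cutoff {N K : Opens I} (hK : K ≤ N) {C : Set ℝ} (hC : IsCompact C)
    (hCN : C ⊆ Set.range (toReal N)) (hKC : ∀ x : K, toReal K x ∈ C) {k : ZMod 2}
    {f : superFun A N} (hf : f ∈ par 𝒜 N k) :
    ∃ g ∈ par 𝒜 (⊤ : Opens I) k, res le_top g = res hK f := by
  -- With `χ` equal to `1` near `C` and zero off the compact set `L` inside `N`, the function `χ f`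
  -- extends smoothly by zero.
  obtain ⟨L, hL, hCL, hLN⟩ := exists_compact_between hC (isOpenEmbedding_toReal N).isOpen_range hCN
  obtain ⟨χ, hχ1, hχ0, -⟩ := exists_contMDiffMap_one_nhds_of_subset_interior (n := (⊤ : ℕ∞))
    𝓘(ℝ, ℝ) hC.isClosed hCL
  have hmem : ∀ t, ambient f.1 t ∈ 𝒜 k := by
    intro t
    by_cases ht : ∃ x, toReal N x = t
    · obtain ⟨x, rfl⟩ := ht
      rw [ambient_apply]
      exact hf x
    · rw [ambient, Function.extend_apply' _ _ _ ht]
      exact zero_mem _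
  refine ⟨ofReal (fun t => χ t • ambient f.1 t) fun ℓ x => ?_, fun x => ?_, ?_⟩
  · simp only [map_smul, smul_eq_mul]
    by_cases hx : toReal ⊤ x ∈ Set.range (toReal N)
    · obtain ⟨y, hy⟩ := hx
      rw [← hy]
      exact (χ.contMDiff.contMDiffAt.contDiffAt).mul (contDiffAt_ambient f ℓ y)
    · refine (contDiffAt_const (c := (0 : ℝ))).congr_of_eventuallyEq ?_
      filter_upwards [hL.isClosed.isOpen_compl.mem_nhds fun h => hx (hLN h)] with t ht
      rw [hχ0 t ht, zero_mul]
  · exact Submodule.smul_mem _ _ (hmem _)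
  · ext x
    change χ (toReal K x) • ambient f.1 (toReal N ⟨x.1, hK x.2⟩) = f.1 ⟨x.1, hK x.2⟩
    rw [hχ1.self_of_nhdsSet _ (hKC x), one_smul, ambient_apply]

end superFun

theorem mul_mul_mul_eq_one {M : Type*} [Monoid M] {a b c d : M} (hab : a * b = 1)
    (hcd : c * d = 1) : a * c * (d * b) = 1 := by
  rw [mul_assoc, ← mul_assoc c, hcd, one_mul, hab]

/-! ### Extension of a change of frame -/

namespace SuperModuleSheaf

variable {E : SuperModuleSheaf.{u, v} I 𝒜}

/-- Two frames with a common interval of definition: one of them can be modified so as to agree with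
the other one on a smaller interval. -/
theorem IsFrame.exists_modification (hI : (I : Set ℝ).OrdConnected) {W₁ W₂ N K : Opens I}
    {s₁ : Fin p ⊕ Fin q → E.sec W₁} {s₂ : Fin p ⊕ Fin q → E.sec W₂} (hs₁ : IsFrame s₁)
    (hs₂ : IsFrame s₂) (h₁ : N ≤ W₁) (h₂ : N ≤ W₂) (hK : K ≤ N)
    (hKc : IsPreconnected (Set.univ : Set K)) (x : K) {C : Set ℝ} (hC : IsCompact C)
    (hCN : C ⊆ Set.range (toReal N)) (hKC : ∀ x : K, toReal K x ∈ C) :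
    ∃ t : Fin p ⊕ Fin q → E.sec W₂, IsFrame t ∧
      SuperModuleSheaf.resTuple (hK.trans h₂) t =
        SuperModuleSheaf.resTuple (hK.trans h₁) s₁ := by
  obtain ⟨g, h, hg, hh, hgh, hhg, hact⟩ :=
    (hs₁.resTuple h₁).exists_transition (hs₂.resTuple h₂)
  -- With this `Γ` the transition matrix satisfies `g' = -gΓ`; unlike `g` itself, `Γ` may be cut
  -- off.
  have hΓ : IsEvenMatrix 𝒜 frameParity (-(h * matDer g)) := (hh.mul hg.matDer).neg
  choose Γ hΓe hΓr using fun k l => exists_cutoff (𝒜 := 𝒜) hK hC hCN hKC (hΓ k l)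
  have hΓK : matRes le_top (Matrix.of Γ) = matRes hK (-(h * matDer g)) := by
    ext1 k l
    exact hΓr k l
  obtain ⟨G, H, hG, hH, hGH, hHG, -, hdH⟩ := exists_fundamental hI
    (Γ := Matrix.of Γ) (π := frameParity (p := p) (q := q)) hΓe
  have hgh' : matRes hK g * matRes hK h = 1 := by rw [← map_mul, hgh, map_one]
  have hhg' : matRes hK h * matRes hK g = 1 := by rw [← map_mul, hhg, map_one]
  have hGH' : ∀ U : Opens I, matRes (le_top : U ≤ ⊤) G * matRes le_top H = 1 := fun U => by
    rw [← map_mul, hGH, map_one]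
  have hHG' : ∀ U : Opens I, matRes (le_top : U ≤ ⊤) H * matRes le_top G = 1 := fun U => by
    rw [← map_mul, hHG, map_one]
  -- On `K`, `g` and `G` solve the same equation, so `gG⁻¹` is constant.
  have hder : matDer (matRes hK g * matRes (le_top : K ≤ ⊤) H) = 0 := by
    rw [matDer_mul, matDer_matRes, matDer_matRes, hdH, map_mul (matRes (le_top : K ≤ ⊤)), hΓK,
      map_neg, map_mul, Matrix.neg_mul, Matrix.mul_neg, ← mul_assoc, ← mul_assoc, hgh', one_mul,
      add_neg_cancel]
  have hcd := congrArg (matEval x) (mul_mul_mul_eq_one hgh' (hHG' K))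
  have hdc := congrArg (matEval x) (mul_mul_mul_eq_one (hGH' K) hhg')
  rw [map_mul (matEval x), map_one] at hcd hdc
  have hconst := eq_matConst_of_matDer_eq_zero hKc hder x
  have hce := IsEvenMatrix.matConst_matEval (U := W₂) ((hg.matRes hK).mul (hH.matRes le_top)) x
  -- Here `c` is the value of `gG⁻¹` and `d` its inverse; as constant matrices they make sense over
  -- all of `W₂`.
  generalize matEval x (matRes hK g * matRes (le_top : K ≤ ⊤) H) = c at hcd hdc hconst hce
  generalize matEval x (matRes (le_top : K ≤ ⊤) G * matRes hK h) = d at hcd hdc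
  have hcd' : matConst W₂ c * matConst W₂ d = 1 := by rw [← map_mul, hcd, map_one]
  have hdc' : matConst W₂ d * matConst W₂ c = 1 := by rw [← map_mul, hdc, map_one]
  refine ⟨SuperModuleSheaf.matAct (matConst W₂ c * matRes le_top G) s₂,
      hs₂.matAct (N := matRes le_top H * matConst W₂ d) (hce.mul (hG.matRes le_top)) ?_ ?_, ?_⟩
  · exact mul_mul_mul_eq_one hcd' (hGH' W₂)
  · exact mul_mul_mul_eq_one (hHG' W₂) hdc'
  · have hgK : matRes hK g = matConst K c * matRes le_top G := by
      rw [← hconst, mul_assoc, hHG', mul_one]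
    rw [← resTuple_resTuple hK h₁, ← hact, resTuple_matAct, resTuple_matAct, resTuple_resTuple,
      hgK, map_mul]
    rfl

end SuperModuleSheaf

/-- The points of `I` strictly between `a` and `b`. -/
def openIoo (I : Opens ℝ) (a b : ℝ) : Opens I :=
  ⟨{x | (x : ℝ) ∈ Set.Ioo a b}, isOpen_Ioo.preimage continuous_subtype_val⟩

theorem isPreconnected_univ_openIoo (hI : (I : Set ℝ).OrdConnected) (a b : ℝ) :
    IsPreconnected (Set.univ : Set (openIoo I a b)) := by
  rw [← (isOpenEmbedding_toReal _).isInducing.isPreconnected_image, Set.image_univ]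
  have : Set.range (toReal (openIoo I a b)) = (I : Set ℝ) ∩ Set.Ioo a b := by
    ext t
    constructor
    · rintro ⟨x, rfl⟩
      exact ⟨x.1.2, x.2⟩
    · rintro ⟨ht, ht'⟩
      exact ⟨⟨⟨t, ht⟩, ht'⟩, rfl⟩
  rw [this]
  exact (hI.inter Set.ordConnected_Ioo).isPreconnected

/-- An open interval is exhausted by a sequence of open intervals with compact closures. -/
theorem exists_exhaustion (hI : (I : Set ℝ).OrdConnected) (x₀ : I) :
    ∃ a b : ℕ → I, (∀ n, a (n + 1) < a n) ∧ (∀ n, b n < b (n + 1)) ∧ (∀ n, a n < x₀ ∧ x₀ < b n) ∧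
      ∀ x, ∃ n, a n < x ∧ x < b n := by
  have hoc : Set.OrdConnected {t | t ∈ I} := hI
  have hot : OrderTopology I := orderTopology_of_ordConnected (t := {t | t ∈ I})
  have hmax : NoMaxOrder I := ⟨fun x => by
    obtain ⟨ε, hε, h⟩ := Metric.isOpen_iff.1 I.isOpen x x.2
    refine ⟨⟨x + ε / 2, h ?_⟩, ?_⟩
    · rw [Metric.mem_ball, Real.dist_eq, add_sub_cancel_left, abs_of_pos] <;> linarith
    · change (x : ℝ) < x + ε / 2
      linarith⟩
  have hmin : NoMinOrder I := ⟨fun x => by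
    obtain ⟨ε, hε, h⟩ := Metric.isOpen_iff.1 I.isOpen x x.2
    refine ⟨⟨x - ε / 2, h ?_⟩, ?_⟩
    · rw [Metric.mem_ball, Real.dist_eq, sub_sub_cancel_left, abs_neg, abs_of_pos] <;> linarith
    · change (x : ℝ) - ε / 2 < x
      linarith⟩
  have : Nonempty I := ⟨x₀⟩
  have htop : ∃ b : ℕ → I, StrictMono b ∧ Filter.Tendsto b Filter.atTop Filter.atTop := by
    obtain ⟨u, -, hu⟩ := Filter.exists_seq_monotone_tendsto_atTop_atTop I
    obtain ⟨φ, hφ, h⟩ := Filter.strictMono_subseq_of_tendsto_atTop hu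
    exact ⟨u ∘ φ, h, hu.comp hφ.tendsto_atTop⟩
  have hbot : ∃ a : ℕ → I, StrictAnti a ∧ Filter.Tendsto a Filter.atTop Filter.atBot := by
    obtain ⟨u, -, hu⟩ := Filter.exists_seq_antitone_tendsto_atTop_atBot I
    obtain ⟨φ, hφ, h⟩ := Filter.strictMono_subseq_of_tendsto_atTop (β := Iᵒᵈ) hu
    exact ⟨u ∘ φ, h, hu.comp hφ.tendsto_atTop⟩
  obtain ⟨a, ha, ha'⟩ := hbot
  obtain ⟨b, hb, hb'⟩ := htop
  -- Shifting the index by `N` puts `x₀` into every interval.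
  obtain ⟨N, hN⟩ := ((ha'.eventually_lt_atBot x₀).and (hb'.eventually_gt_atTop x₀)).exists
  refine ⟨fun n => a (n + N), fun n => b (n + N), fun n => ha (by omega), fun n => hb (by omega),
    fun n => ⟨(ha.antitone (by omega)).trans_lt hN.1, hN.2.trans_le (hb.monotone (by omega))⟩,
    fun x => ?_⟩
  obtain ⟨n, hn⟩ := ((ha'.eventually_lt_atBot x).and (hb'.eventually_gt_atTop x)).exists
  exact ⟨n, (ha.antitone (by omega)).trans_lt hn.1, hn.2.trans_le (hb.monotone (by omega))⟩

/-! ### From local frames to a global frame -/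

namespace SuperModuleSheaf

/-- The sheaf `E` has a frame of super rank `(p, q)` over `W`. -/
def HasFrame (E : SuperModuleSheaf.{u, v} I 𝒜) (p q : ℕ) (W : Opens I) : Prop :=
  ∃ s : Fin p ⊕ Fin q → E.sec W, IsFrame s

variable {E : SuperModuleSheaf.{u, v} I 𝒜} {p q : ℕ}

theorem HasFrame.mono {V W : Opens I} (h : HasFrame E p q W) (hVW : V ≤ W) : HasFrame E p q V :=
  h.imp' (SuperModuleSheaf.resTuple hVW) fun _ hs => hs.resTuple hVW

theorem hasFrame_bool {V₁ V₂ : Opens I} {s : Fin p ⊕ Fin q → E.sec V₁}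
    {t : Fin p ⊕ Fin q → E.sec V₂} (hs : IsFrame s) (ht : IsFrame t)
    (h : SuperModuleSheaf.resTuple (inf_le_left : V₁ ⊓ V₂ ≤ V₁) s =
      SuperModuleSheaf.resTuple inf_le_right t) :
    HasFrame E p q (⨆ i : Bool, Bool.rec V₁ V₂ i) := by
  refine exists_isFrame_iSup (fun i : Bool => Bool.rec V₁ V₂ i)
    (fun i => Bool.rec s t i) (fun i => Bool.rec hs ht i) fun i j => ?_
  cases i <;> cases j
  · rfl
  · exact h
  · have h' := congrArg (SuperModuleSheaf.resTuple (inf_comm V₂ V₁).le) h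
    rw [resTuple_resTuple, resTuple_resTuple] at h'
    exact h'.symm
  · rfl

/-- The second frame is altered to agree with the first near `c`. Then the first is kept to the left
of `c + ε / 2` and the second to the right of `c - ε / 2`, so that the overlap lies where they
agree. -/
theorem HasFrame.join (hI : (I : Set ℝ).OrdConnected) {W₁ W₂ : Opens I}
    (h₁ : HasFrame E p q W₁) (h₂ : HasFrame E p q W₂) {c : I} (hc₁ : c ∈ W₁) (hc₂ : c ∈ W₂) :
    ∃ W, HasFrame E p q W ∧ (∀ x ∈ W₁, x ≤ c → x ∈ W) ∧ ∀ x ∈ W₂, c ≤ x → x ∈ W := by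
  obtain ⟨s₁, hs₁⟩ := h₁
  obtain ⟨s₂, hs₂⟩ := h₂
  obtain ⟨ε, hε, hball⟩ := Metric.isOpen_iff.1
    (isOpenEmbedding_toReal (W₁ ⊓ W₂)).isOpen_range c ⟨⟨c, hc₁, hc₂⟩, rfl⟩
  have hcN : Metric.closedBall (c : ℝ) (ε / 2) ⊆ Set.range (toReal (W₁ ⊓ W₂)) :=
    (Metric.closedBall_subset_ball (by linarith)).trans hball
  have hKC : ∀ x : openIoo I (c - ε / 2) (c + ε / 2),
      toReal _ x ∈ Metric.closedBall (c : ℝ) (ε / 2) := by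
    rintro ⟨x, hx⟩
    rw [Real.closedBall_eq_Icc]
    exact Set.Ioo_subset_Icc_self hx
  have hKN : openIoo I (c - ε / 2) (c + ε / 2) ≤ W₁ ⊓ W₂ := by
    intro x hx
    obtain ⟨y, hy⟩ := hcN (hKC ⟨x, hx⟩)
    have : y.1 = x := Subtype.ext hy
    exact this ▸ y.2
  have hcK : c ∈ openIoo I (c - ε / 2) (c + ε / 2) := by
    constructor <;> linarith
  obtain ⟨t, ht, hts⟩ := hs₁.exists_modification hI hs₂ inf_le_left inf_le_right hKN
    (isPreconnected_univ_openIoo hI _ _) ⟨c, hcK⟩ (isCompact_closedBall _ _) hcN hKC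
  let V₁ : Opens I := W₁ ⊓ ⟨{x | (x : ℝ) ∈ Set.Iio ((c : ℝ) + ε / 2)},
    isOpen_Iio.preimage continuous_subtype_val⟩
  let V₂ : Opens I := W₂ ⊓ ⟨{x | (x : ℝ) ∈ Set.Ioi ((c : ℝ) - ε / 2)},
    isOpen_Ioi.preimage continuous_subtype_val⟩
  have hV : V₁ ⊓ V₂ ≤ openIoo I (c - ε / 2) (c + ε / 2) := fun x hx => ⟨hx.2.2, hx.1.2⟩
  have hV₁ : V₁ ≤ W₁ := inf_le_left
  have hV₂ : V₂ ≤ W₂ := inf_le_left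
  refine ⟨_, hasFrame_bool (hs₁.resTuple hV₁) (ht.resTuple hV₂) ?_, fun x hx hxc => ?_,
    fun x hx hxc => ?_⟩
  · have h' := congrArg (SuperModuleSheaf.resTuple hV) hts
    rw [resTuple_resTuple, resTuple_resTuple] at h' ⊢
    exact h'.symm
  · have hxc' : (x : ℝ) ≤ c := hxc
    exact Opens.mem_iSup.2 ⟨false, hx, show (x : ℝ) < c + ε / 2 by linarith⟩
  · have hxc' : (c : ℝ) ≤ x := hxc
    exact Opens.mem_iSup.2 ⟨true, hx, show (c : ℝ) - ε / 2 < x by linarith⟩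

/-- A locally trivial sheaf has a frame near every compact interval. -/
theorem exists_hasFrame_Icc (hI : (I : Set ℝ).OrdConnected)
    (hE : ∀ x : I, ∃ W, x ∈ W ∧ HasFrame E p q W) {a b : I} (hab : a ≤ b) :
    ∃ W, HasFrame E p q W ∧ ∀ x, a ≤ x → x ≤ b → x ∈ W := by
  choose W hxW hW using hE
  let i : Set.Icc (a : ℝ) b → I := fun t => ⟨t, hI.out a.2 b.2 t.2⟩
  have hi : Continuous i := Continuous.subtype_mk continuous_subtype_val _
  -- A subdivision of `[a, b]` with each step inside one trivializing set; frames are then joined at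
  -- the points `t n`.
  obtain ⟨t, ht0, htm, ⟨m, hm⟩, htW⟩ := exists_monotone_Icc_subset_open_cover_Icc
    (show (a : ℝ) ≤ b from hab) (c := fun x : I => i ⁻¹' (W x))
    (fun x => (W x).isOpen.preimage hi) fun y _ => Set.mem_iUnion.2 ⟨i y, hxW (i y)⟩
  have key : ∀ n, ∃ V, HasFrame E p q V ∧ ∀ x, a ≤ x → x ≤ i (t n) → x ∈ V := by
    intro n
    induction n with
    | zero =>
      refine ⟨W a, hW a, fun x hx hx' => ?_⟩
      have : i (t 0) = a := Subtype.ext ht0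
      rw [this] at hx'
      exact le_antisymm hx hx' ▸ hxW a
    | succ n ih =>
      obtain ⟨V, hV, hVa⟩ := ih
      obtain ⟨z, hz⟩ := htW n
      have han : a ≤ i (t n) := (t n).2.1
      obtain ⟨V', hV', h1, h2⟩ := hV.join hI (hW z) (c := i (t n)) (hVa _ han le_rfl)
        (hz ⟨le_rfl, htm n.le_succ⟩)
      refine ⟨V', hV', fun x hx hx' => ?_⟩
      rcases le_total x (i (t n)) with h | h
      · exact h1 x (hVa x hx h) h
      · have hxb : x ≤ b := hx'.trans (t (n + 1)).2.2
        exact h2 x (hz (a := ⟨x, hx, hxb⟩) ⟨h, hx'⟩) h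
  obtain ⟨V, hV, h⟩ := key m
  refine ⟨V, hV, fun x hx hx' => h x hx (hx'.trans_eq (Subtype.ext (hm m le_rfl).symm))⟩

/-- A locally trivial sheaf on an open interval has a global frame. -/
theorem hasFrame_top (hI : (I : Set ℝ).OrdConnected)
    (hE : ∀ x : I, ∃ W, x ∈ W ∧ HasFrame E p q W) : HasFrame E p q ⊤ := by
  rcases isEmpty_or_nonempty I with he | ⟨⟨x₀⟩⟩
  -- The empty interval is covered by the empty family, so any tuple is a frame.
  · exact ⟨fun _ => 0, IsFrame.of_local (V := fun i : Empty => i.elim) (fun i => i.elim)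
      (fun x _ => he.elim x) fun i => i.elim⟩
  obtain ⟨a, b, ha, hb, hab, hx⟩ := exists_exhaustion hI x₀
  let J : ℕ → Opens I := fun n => openIoo I (a n) (b n)
  have hJ : ∀ n, J n ≤ J (n + 1) := fun n x hx => ⟨lt_trans (ha n) hx.1, lt_trans hx.2 (hb n)⟩
  have hJm : Monotone J := monotone_nat_of_le_succ hJ
  have hJF : ∀ n, HasFrame E p q (J n) := by
    intro n
    obtain ⟨W, hW, h⟩ := exists_hasFrame_Icc hI hE ((hab n).1.trans (hab n).2).le
    exact hW.mono fun x hx => h x (le_of_lt hx.1) (le_of_lt hx.2)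
  have step : ∀ (n : ℕ) (s : {s : Fin p ⊕ Fin q → E.sec (J (n + 1)) // IsFrame s}),
      ∃ t : {t : Fin p ⊕ Fin q → E.sec (J (n + 2)) // IsFrame t},
        resTuple ((hJ n).trans (hJ (n + 1))) t.1 = resTuple (hJ n) s.1 := by
    rintro n ⟨s, hs⟩
    obtain ⟨σ, hσ⟩ := hJF (n + 2)
    -- The endpoints move strictly, so `[a n, b n]` is a compact subset of `J (n + 1)`: there is
    -- room for the cutoff, at the price of agreement on `J n` only.
    obtain ⟨t, ht, hts⟩ := hs.exists_modification hI hσ le_rfl (hJ (n + 1)) (hJ n)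
      (isPreconnected_univ_openIoo hI _ _) ⟨x₀, hab n⟩ (isCompact_Icc (a := (a n : ℝ)) (b := b n))
      (fun y hy => ⟨⟨⟨y, hI.out (a n).2 (b n).2 hy⟩, lt_of_lt_of_le (ha n) hy.1,
        lt_of_le_of_lt hy.2 (hb n)⟩, rfl⟩) fun y => Set.Ioo_subset_Icc_self y.2
    exact ⟨⟨t, ht⟩, hts⟩
  choose next hnext using step
  obtain ⟨σ, hσ⟩ := hJF 1
  let s : ∀ n, {s : Fin p ⊕ Fin q → E.sec (J (n + 1)) // IsFrame s} := fun n =>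
    Nat.rec ⟨σ, hσ⟩ next n
  -- Consecutive frames agree one interval further in, so each is restricted from `J (n + 1)` to `J
  -- n` before gluing.
  let r : ∀ n, Fin p ⊕ Fin q → E.sec (J n) := fun n => resTuple (hJ n) (s n).1
  have hr : ∀ n, resTuple (hJ n) (r (n + 1)) = r n := by
    intro n
    rw [resTuple_resTuple]
    exact hnext n (s n)
  have hrm : ∀ i j (h : i ≤ j), resTuple (hJm h) (r j) = r i := by
    intro i j h
    induction j, h using Nat.le_induction with
    | base => exact resTuple_self _
    | succ j h ih =>
      have h' := congrArg (resTuple (hJm h)) (hr j)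
      rw [resTuple_resTuple] at h'
      exact h'.trans ih
  have hcompat : ∀ i j, i ≤ j → ∀ (U : Opens I) (hi : U ≤ J i) (hj : U ≤ J j),
      resTuple hi (r i) = resTuple hj (r j) := by
    intro i j h U hi hj
    rw [← hrm i j h, resTuple_resTuple]
  have htop : (⊤ : Opens I) = ⨆ n, J n :=
    (eq_top_iff.2 fun x _ => Opens.mem_iSup.2 (hx x)).symm
  rw [htop]
  refine exists_isFrame_iSup J r (fun n => (s n).2.resTuple (hJ n)) fun i j => ?_
  rcases le_total i j with h | h
  · exact hcompat i j h _ _ _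
  · exact (hcompat j i h _ _ _).symm

end SuperModuleSheaf

theorem IsSuperVectorBundle.nonempty_superIso (hI : (I : Set ℝ).OrdConnected)
    {E : SuperModuleSheaf.{u, v} I 𝒜} {p q : ℕ} (hE : IsSuperVectorBundle E p q) :
    Nonempty (SuperIso E (trivialBundle I 𝒜 p q) ⊤) := by
  obtain ⟨s, hs⟩ := SuperModuleSheaf.hasFrame_top (E := E) (p := p) (q := q) hI fun x => by
    obtain ⟨W, hx, ⟨φ⟩⟩ := hE x
    exact ⟨W, hx, SuperModuleSheaf.exists_isFrame_of_superIso φ⟩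
  exact ⟨hs.superIso⟩

end Interval

theorem theorem2p12 {P : Type u} [Ring P] [Algebra ℝ P] [FiniteDimensional ℝ P]
    (𝓟 : ZMod 2 → Submodule ℝ P) [GradedAlgebra 𝓟] [IsSmallAlgebra 𝓟]
    (I : Opens ℝ) (hI : (I : Set ℝ).OrdConnected) :
    -- (i) every `P`-super vector bundle on `I^{|n}` is trivial
    (∀ (n p q : ℕ)
      (E : SuperModuleSheaf.{u, v} I (totalParity 𝓟 (exteriorParity n))),
      IsSuperVectorBundle E p q →
        Nonempty (SuperIso E (trivialBundle I (totalParity 𝓟 (exteriorParity n)) p q) ⊤)) ∧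
    -- (ii) every `P`-connection on a trivial bundle on `I` is equivalent to the trivial one
    (∀ (p q : ℕ) (nabla : SuperConnection (trivialBundle I 𝓟 p q)),
      ∃ φ : SuperIso (trivialBundle I 𝓟 p q) (trivialBundle I 𝓟 p q) ⊤,
        φ.IsParallel (trivialConnection I 𝓟 p q) nabla) ∧
    -- (iii) existence, uniqueness, `P`-linearity and evenness of the parallel transport
    (∀ (p q : ℕ) (nabla : SuperConnection (trivialBundle I 𝓟 p q)) (t₀ : SuperPoint I 𝓟),
      ∃ τ : (Fin p ⊕ Fin q → P) → (trivialBundle I 𝓟 p q).sec ⊤,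
        ((∀ v, t₀.eval (τ v) = v) ∧ ∀ v, nabla.IsParallelSection (τ v)) ∧
        (∀ τ' : (Fin p ⊕ Fin q → P) → (trivialBundle I 𝓟 p q).sec ⊤,
          ((∀ v, t₀.eval (τ' v) = v) ∧ ∀ v, nabla.IsParallelSection (τ' v)) → τ' = τ) ∧
        (∀ v w, τ (v + w) = τ v + τ w) ∧
        (∀ (c : P) v, τ (c • v) = superFun.const (⊤ : Opens I) c • τ v) ∧
        (∀ (k : ZMod 2) v, v ∈ freePar 𝓟 p q k → τ v ∈ (trivialBundle I 𝓟 p q).par ⊤ k)) := by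
  exact ⟨fun _ _ _ _ hE => hE.nonempty_superIso hI,
    fun _ _ nabla => nabla.exists_parallel_superIso hI,
    fun _ _ nabla t₀ => nabla.exists_parallel_transport hI t₀⟩
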